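/- Let $\mathcal H_S$ and $\mathcal H_E$ be complex Hilbert spaces. Let $H_S$, $F$ be self-adjoint operators on $\mathcal H_S$ and $H_E$, $G$ self-adjoint operators on $\mathcal H_E$, where $H_S\ge 0$, $H_E\ge 0$, the operators $F,F^2$ (respectively $G,G^2$) are defined and essentially self-adjoint on the domain of $H_S$ (respectively $H_E$), and $H_S-\tfrac12F^2$, $H_E-\tfrac12G^2$ are bounded below. Assume that the spectral projections of $H_S$ commute with those of $F$, and let $P_S$ be the spectral measure of $F$. Let $U(t)=e^{-iHt}$ be the unitary group generated by $H=H_S\otimes I+I\otimes H_E+F\otimes G$ on $\mathcal H_S\otimes\mathcal H_E$, let $\omega$ be a statistical operator (positive, of trace one) on $\mathcal H_E$, and put, for $A\in\mathcal B(\mathcal H_S)$ and $\alpha,\beta,t\in\mathbb R$, $$A(t)=\mathrm{tr}_E\bigl(U(t)^*(A\otimes I)U(t)(I\otimes\omega)\bigr)\in\mathcal B(\mathcal H_S),\qquad \chi(\alpha,\beta;t)=\mathrm{tr}\bigl(e^{i(H_E+\alpha G)t}e^{-i(H_E+\beta G)t}\omega\bigr).$$ Let $\psi(t)\ge 0$ for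 $t\ge0$, let $c\in\mathbb R$, $\gamma>0$ and $\delta>0$, and assume that for all $t\ge 0$ and all $\alpha,\beta\in\mathbb R$ with $|\alpha-\beta|\ge\delta$ the function $\chi(\cdot,\beta;t)$ is differentiable at $\alpha$ and $$\left|\frac{\partial^n}{\partial\alpha^n}\chi(\alpha,\beta;t)\right|\le c\,\bigl(1+(\alpha-\beta)^2\psi(t)\bigr)^{-\gamma},\qquad n=0,1.$$ Then the partial trace $A(t)$ exists for all $A\in\mathcal B(\mathcal H_S)$ and $t\in\mathbb R$, and for all closed intervals $\Delta_1,\Delta_2\subset\mathbb R$ with $|\alpha-\beta|\ge\delta$ for $\alpha\in\Delta_1$, $\beta\in\Delta_2$ (in particular, if their distance is $\delta$), all $A\in\mathcal B(\mathcal H_S)$ and all $t\ge0$, $$\|P_S(\Delta_1)A(t)P_S(\Delta_2)\|\le c\,(2+|\Delta_j|)\,\|A\|\,\bigl(1+\delta^2\psi(t)\bigr)^{-\gamma}$$ for each $j\in\{1,2\}$ such that $\Delta_j$ is bounded, where $|\Delta_j|$ is the length of $\Delta_j$. In particular, if at least one of the intervals is bounded, the estimate holds with a constant that does not depend on $t$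 or $A$. -/

import Mathlib

open scoped TensorProduct InnerProductSpace

noncomputable section

namespace InducedSuperselection

variable {E E₁ E₂ : Type*}
  [NormedAddCommGroup E] [InnerProductSpace ℂ E]
  [NormedAddCommGroup E₁] [InnerProductSpace ℂ E₁]
  [NormedAddCommGroup E₂] [InnerProductSpace ℂ E₂]

/-! ### Unbounded operators -/

/-- The square `F²` of an unbounded operator, with domain `{x ∈ D(F) | F x ∈ D(F)}`. -/
def square (F : E →ₗ.[ℂ] E) : E →ₗ.[ℂ] E where
  domain :=
    { carrier := {x | ∃ h : x ∈ F.domain, F ⟨x, h⟩ ∈ F.domain}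
      zero_mem' := ⟨F.domain.zero_mem, by
        have h : F ⟨0, F.domain.zero_mem⟩ = 0 := F.map_zero
        rw [h]; exact F.domain.zero_mem⟩
      add_mem' := by
        rintro x y ⟨hx, hx'⟩ ⟨hy, hy'⟩
        refine ⟨F.domain.add_mem hx hy, ?_⟩
        have h := F.map_add ⟨x, hx⟩ ⟨y, hy⟩
        exact h ▸ F.domain.add_mem hx' hy'
      smul_mem' := by
        rintro a x ⟨hx, hx'⟩
        refine ⟨F.domain.smul_mem a hx, ?_⟩
        have h := F.map_smul a ⟨x, hx⟩
        exact h ▸ F.domain.smul_mem a hx' }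
  toFun :=
    { toFun := fun x => F ⟨F ⟨x.1, x.2.1⟩, x.2.2⟩
      map_add' := by
        intro x y
        rw [← F.map_add]
        congr 1
        apply Subtype.ext
        exact F.map_add ⟨x.1, x.2.1⟩ ⟨y.1, y.2.1⟩
      map_smul' := by
        intro a x
        rw [RingHom.id_apply, ← F.map_smul]
        congr 1
        apply Subtype.ext
        exact F.map_smul a ⟨x.1, x.2.1⟩ }

/-- `A` is essentially self-adjoint: its closure is self-adjoint. -/
def IsEssentiallySelfAdjoint [CompleteSpace E] (A : E →ₗ.[ℂ] E) : Prop :=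
  A.IsClosable ∧ IsSelfAdjoint A.closure

/-- `H` is a positive self-adjoint operator, `F` is a self-adjoint operator, `F` and `F²` are
defined and essentially self-adjoint on the domain of `H`, and `H - ½ F²` is bounded below. -/
structure IsAdmissiblePair [CompleteSpace E] (H F : E →ₗ.[ℂ] E) : Prop where
  selfAdjoint_left : IsSelfAdjoint H
  nonneg_left : ∀ x : H.domain, 0 ≤ (⟪(x : E), H x⟫_ℂ).re
  selfAdjoint_right : IsSelfAdjoint F
  domain_le : H.domain ≤ (square F).domain
  essentiallySelfAdjoint : IsEssentiallySelfAdjoint (F.domRestrict H.domain)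
  essentiallySelfAdjoint_square : IsEssentiallySelfAdjoint ((square F).domRestrict H.domain)
  semibounded : ∃ m : ℝ, ∀ (x : E) (hx : x ∈ H.domain),
    m * ‖x‖ ^ 2 ≤
      (⟪x, H ⟨x, hx⟩⟫_ℂ).re - (1 / 2) * (⟪x, square F ⟨x, domain_le hx⟩⟫_ℂ).re

/-- `U` is a strongly continuous one-parameter group of unitary operators whose generator extends
the operator `A`, i.e. `d/dt U(t) x = -i A x` at `t = 0` for all `x ∈ D(A)`. If `A` is essentially
self-adjoint, this says exactly that `U(t) = exp(-i t A)`, with `A` standing for its closure. -/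
structure IsUnitaryGroupOf [CompleteSpace E] (A : E →ₗ.[ℂ] E) (U : ℝ → E →L[ℂ] E) : Prop where
  unitary : ∀ t, U t ∈ unitary (E →L[ℂ] E)
  map_zero : U 0 = 1
  map_add : ∀ s t, U (s + t) = U s * U t
  continuous : ∀ x, Continuous fun t => U t x
  hasDerivAt : ∀ x : A.domain, HasDerivAt (fun t => U t (x : E)) (-Complex.I • A x) 0

/-! ### Projection-valued measures on the real line -/

/-- A projection-valued measure on `ℝ`. The values on non-measurable sets are irrelevant. -/
structure ProjectionMeasure (E : Type*) [NormedAddCommGroup E] [InnerProductSpace ℂ E]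
    [CompleteSpace E] where
  proj : Set ℝ → E →L[ℂ] E
  isStarProjection : ∀ s, MeasurableSet s → IsStarProjection (proj s)
  empty : proj ∅ = 0
  univ : proj Set.univ = 1
  inter : ∀ s t, MeasurableSet s → MeasurableSet t → proj (s ∩ t) = proj s * proj t
  hasSum_iUnion : ∀ s : ℕ → Set ℝ, (∀ n, MeasurableSet (s n)) →
    Pairwise (Function.onFun Disjoint s) → ∀ x, HasSum (fun n => proj (s n) x) (proj (⋃ n, s n) x)

theorem ProjectionMeasure.norm_sq_eq [CompleteSpace E] (P : ProjectionMeasure E) {s : Set ℝ}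
    (hs : MeasurableSet s) (x : E) : ‖P.proj s x‖ ^ 2 = (⟪x, P.proj s x⟫_ℂ).re := by
  have hp := P.isStarProjection s hs
  have h1 : P.proj s (P.proj s x) = P.proj s x :=
    congrArg (fun T : E →L[ℂ] E => T x) hp.isIdempotentElem.eq
  have h2 : ContinuousLinearMap.adjoint (P.proj s) = P.proj s := hp.isSelfAdjoint
  have h3 : ⟪P.proj s x, P.proj s x⟫_ℂ = ⟪x, P.proj s x⟫_ℂ := by
    rw [← ContinuousLinearMap.adjoint_inner_right, h2, h1]
  rw [← h3, ← inner_self_eq_norm_sq (𝕜 := ℂ)]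
  rfl

/-- The finite measure `s ↦ ⟪x, P(s) x⟫ = ‖P(s) x‖²`. -/
def ProjectionMeasure.measure [CompleteSpace E] (P : ProjectionMeasure E) (x : E) :
    MeasureTheory.Measure ℝ :=
  MeasureTheory.Measure.ofMeasurable (fun s _ => ENNReal.ofReal (‖P.proj s x‖ ^ 2))
    (by simp [P.empty])
    (by
      intro s hs hd
      have h := P.hasSum_iUnion s hs hd x
      have h2 : HasSum (fun n => ‖P.proj (s n) x‖ ^ 2) (‖P.proj (⋃ n, s n) x‖ ^ 2) := by
        have h3 := Complex.reCLM.hasSum ((innerSL ℂ x).hasSum h)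
        simp only [innerSL_apply_apply, Complex.reCLM_apply] at h3
        rw [P.norm_sq_eq (MeasurableSet.iUnion hs)]
        simp_rw [fun n => P.norm_sq_eq (hs n) x]
        exact h3
      rw [← h2.tsum_eq]
      exact ENNReal.ofReal_tsum_of_nonneg (fun n => by positivity) h2.summable)

/-- `P` is the spectral measure of `F`: one has `F = ∫ l P(dl)`, where `D(F)` consists of the
vectors `x` with `∫ l² ⟪x, P(dl) x⟫ < ∞`, and `⟪x, F x⟫ = ∫ l ⟪x, P(dl) x⟫` for `x ∈ D(F)`. -/
structure IsSpectralMeasure [CompleteSpace E] (F : E →ₗ.[ℂ] E) (P : ProjectionMeasure E) :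
    Prop where
  mem_domain_iff : ∀ x, x ∈ F.domain ↔ ∫⁻ l, ENNReal.ofReal (l ^ 2) ∂(P.measure x) < ⊤
  inner_apply : ∀ x : F.domain, ⟪(x : E), F x⟫_ℂ = ((∫ l, l ∂(P.measure (x : E)) : ℝ) : ℂ)

/-! ### Tensor products -/

/-- The Hilbert space tensor product. -/
abbrev HilbertTensor (E₁ E₂ : Type*) [NormedAddCommGroup E₁] [InnerProductSpace ℂ E₁]
    [NormedAddCommGroup E₂] [InnerProductSpace ℂ E₂] : Type _ :=
  UniformSpace.Completion (E₁ ⊗[ℂ] E₂)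

/-- The simple tensor `x ⊗ y` in the Hilbert space tensor product. -/
def tmul (x : E₁) (y : E₂) : HilbertTensor E₁ E₂ := ((x ⊗ₜ[ℂ] y : E₁ ⊗[ℂ] E₂) : HilbertTensor E₁ E₂)

/-- The bounded operator `A ⊗ B` on the Hilbert space tensor product. -/
def boundedTensor (A : E₁ →L[ℂ] E₁) (B : E₂ →L[ℂ] E₂) :
    HilbertTensor E₁ E₂ →L[ℂ] HilbertTensor E₁ E₂ :=
  ContinuousLinearMap.extend
    (UniformSpace.Completion.toComplL.comp (TensorProduct.mapL A B))
    (UniformSpace.Completion.toComplL : (E₁ ⊗[ℂ] E₂) →L[ℂ] HilbertTensor E₁ E₂)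

theorem boundedTensor_tmul (A : E₁ →L[ℂ] E₁) (B : E₂ →L[ℂ] E₂) (x : E₁) (y : E₂) :
    boundedTensor A B (tmul x y) = tmul (A x) (B y) :=
  ContinuousLinearMap.extend_eq _ UniformSpace.Completion.denseRange_coe
    (UniformSpace.Completion.isUniformInducing_coe _) (x ⊗ₜ[ℂ] y)

/-- The embedding of `D(S) ⊗ D(T)` (algebraic tensor product) into the Hilbert space tensor
product. -/
def domainEmbedding (D₁ : Submodule ℂ E₁) (D₂ : Submodule ℂ E₂) :
    D₁ ⊗[ℂ] D₂ →ₗ[ℂ] HilbertTensor E₁ E₂ :=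
  (UniformSpace.Completion.toComplₗᵢ (𝕜 := ℂ) (E := E₁ ⊗[ℂ] E₂)).toLinearMap ∘ₗ
    TensorProduct.map D₁.subtype D₂.subtype

theorem domainEmbedding_injective (D₁ : Submodule ℂ E₁) (D₂ : Submodule ℂ E₂) :
    Function.Injective (domainEmbedding D₁ D₂) :=
  (UniformSpace.Completion.toComplₗᵢ (𝕜 := ℂ) (E := E₁ ⊗[ℂ] E₂)).injective.comp
    (TensorProduct.map_injective_of_flat_flat _ _ D₁.subtype_injective D₂.subtype_injective)

/-- The tensor product `S ⊗ T` of two unbounded operators: its domain is the algebraic tensor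
product `D(S) ⊗ D(T)`, and it sends `x ⊗ y` to `S x ⊗ T y`. -/
def unboundedTensor (S : E₁ →ₗ.[ℂ] E₁) (T : E₂ →ₗ.[ℂ] E₂) :
    HilbertTensor E₁ E₂ →ₗ.[ℂ] HilbertTensor E₁ E₂ where
  domain := LinearMap.range (domainEmbedding S.domain T.domain)
  toFun := (UniformSpace.Completion.toComplₗᵢ (𝕜 := ℂ) (E := E₁ ⊗[ℂ] E₂)).toLinearMap ∘ₗ
    TensorProduct.map S.toFun T.toFun ∘ₗ
    (LinearEquiv.ofInjective _ (domainEmbedding_injective S.domain T.domain)).symm.toLinearMap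

theorem tmul_mem_unboundedTensor_domain (S : E₁ →ₗ.[ℂ] E₁) (T : E₂ →ₗ.[ℂ] E₂)
    (x : S.domain) (y : T.domain) :
    tmul (x : E₁) (y : E₂) ∈ (unboundedTensor S T).domain :=
  ⟨x ⊗ₜ[ℂ] y, rfl⟩

theorem unboundedTensor_tmul (S : E₁ →ₗ.[ℂ] E₁) (T : E₂ →ₗ.[ℂ] E₂)
    (x : S.domain) (y : T.domain) :
    unboundedTensor S T ⟨tmul (x : E₁) (y : E₂), tmul_mem_unboundedTensor_domain S T x y⟩ =
      tmul (S x) (T y) := by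
  have h : (LinearEquiv.ofInjective _ (domainEmbedding_injective S.domain T.domain)).symm
      ⟨tmul (x : E₁) (y : E₂), tmul_mem_unboundedTensor_domain S T x y⟩ = x ⊗ₜ[ℂ] y := by
    rw [LinearEquiv.symm_apply_eq]
    rfl
  exact congrArg (fun z => UniformSpace.Completion.toComplₗᵢ (𝕜 := ℂ) (E := E₁ ⊗[ℂ] E₂)
    (TensorProduct.map S.toFun T.toFun z)) h

/-- The identity operator, as an everywhere defined unbounded operator. -/
def identity (E : Type*) [NormedAddCommGroup E] [InnerProductSpace ℂ E] : E →ₗ.[ℂ] E :=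
  (LinearMap.id : E →ₗ[ℂ] E).toPMap ⊤

/-- The total Hamiltonian `H_S ⊗ I + I ⊗ H_E + F ⊗ G`, on the intersection of the domains of its
three terms. -/
def totalHamiltonian (HS F : E₁ →ₗ.[ℂ] E₁) (HE G : E₂ →ₗ.[ℂ] E₂) :
    HilbertTensor E₁ E₂ →ₗ.[ℂ] HilbertTensor E₁ E₂ :=
  unboundedTensor HS (identity E₂) + unboundedTensor (identity E₁) HE + unboundedTensor F G

/-! ### Traces, states and the reduced Heisenberg dynamics -/

/-- The index set of a chosen orthonormal basis of a Hilbert space. -/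
def basisIndex (E : Type*) [NormedAddCommGroup E] [InnerProductSpace ℂ E] [CompleteSpace E] :
    Set E :=
  (exists_hilbertBasis ℂ E).choose

/-- A chosen orthonormal basis of a Hilbert space. -/
def basis (E : Type*) [NormedAddCommGroup E] [InnerProductSpace ℂ E] [CompleteSpace E] :
    HilbertBasis (basisIndex E) ℂ E :=
  (exists_hilbertBasis ℂ E).choose_spec.choose

/-- The trace. For trace class operators, the only ones to which it is applied, the sum converges
absolutely and does not depend on the orthonormal basis. -/
def trace [CompleteSpace E] (T : E →L[ℂ] E) : ℂ :=
  ∑' i, ⟪basis E i, T (basis E i)⟫_ℂ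

/-- A statistical operator: a positive operator of trace one. -/
def IsStatisticalOperator [CompleteSpace E] (ω : E →L[ℂ] E) : Prop :=
  ω.IsPositive ∧ HasSum (fun i => ⟪basis E i, ω (basis E i)⟫_ℂ) 1

/-- `B` is the partial trace of `T` over the second tensor factor:
`⟪f, B g⟫ = ∑ i, ⟪f ⊗ e i, T (g ⊗ e i)⟫`. There is at most one such `B`. -/
def HasPartialTrace [CompleteSpace E₂] (T : HilbertTensor E₁ E₂ →L[ℂ] HilbertTensor E₁ E₂)
    (B : E₁ →L[ℂ] E₁) : Prop :=
  ∀ f g : E₁, HasSum (fun i => ⟪tmul f (basis E₂ i), T (tmul g (basis E₂ i))⟫_ℂ) ⟪f, B g⟫_ℂ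

/-- The operator `U⁺(t) (A ⊗ I) U(t) (I ⊗ ω)` on the total Hilbert space. -/
def weightedObservable (U : ℝ → HilbertTensor E₁ E₂ →L[ℂ] HilbertTensor E₁ E₂)
    (ω : E₂ →L[ℂ] E₂) (A : E₁ →L[ℂ] E₁) (t : ℝ) : HilbertTensor E₁ E₂ →L[ℂ] HilbertTensor E₁ E₂ :=
  ContinuousLinearMap.adjoint (U t) * boundedTensor A 1 * U t * boundedTensor 1 ω

open Classical in
/-- The reduced Heisenberg observable `A(t) = tr_E U⁺(t) (A ⊗ I) U(t) ω`. -/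
def reducedHeisenberg [CompleteSpace E₂] (U : ℝ → HilbertTensor E₁ E₂ →L[ℂ] HilbertTensor E₁ E₂)
    (ω : E₂ →L[ℂ] E₂) (A : E₁ →L[ℂ] E₁) (t : ℝ) : E₁ →L[ℂ] E₁ :=
  if h : ∃ B, HasPartialTrace (weightedObservable U ω A t) B then h.choose else 0

/-- The environment trace `χ(α, β; t) = tr (exp(i t (H_E + α G)) exp(-i t (H_E + β G)) ω)`, where
`V α t` stands for `exp(-i t (H_E + α G))`. -/
def environmentTrace [CompleteSpace E] (V : ℝ → ℝ → E →L[ℂ] E) (ω : E →L[ℂ] E) (α β t : ℝ) : ℂ :=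
  trace (V α (-t) * V β t * ω)

end InducedSuperselection

end

open InducedSuperselection

/-!
The total time evolution is diagonal with respect to the coupling operator `F`: on a spectral
subspace of `F` near the value `α` it acts like `exp(-i t HS) ⊗ exp(-i t (HE + α G))`. Hence the
reduced observable is the double operator integral `∫∫ χ(α, β; t) P(dα) A₀(t) P(dβ)` with
`A₀(t) = exp(i t HS) A exp(-i t HS)`. If `χ` is bounded by `C` and has an `α`-derivative bounded by
`C`, then partial integration in `α` bounds the block between `Δ₁` and `Δ₂` by `C (1 + |Δ₁|) ‖A‖`;
since `χ(α, β; t)` and `χ(β, α; t)` are complex conjugates, `|Δ₂|` can take the place of `|Δ₁|`.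

Neither `exp(-i t HS)` nor operator integrals are constructed. Everything is done with finite
partitions of spectral intervals of `F` (cells of size `1 / n`) and of `HS` (cells of size `1 / n²`,
on which `exp(-i t HS)` is replaced by a phase factor), and partial integration becomes the
summation by parts of `norm_sum_mul_inner_le`. The argument rests on the following facts.

* `IsSpectralMeasure.norm_apply_sub_le`: on the spectral subspace of a set within distance `ε`
  of `α`, the operator differs from `α` by at most `ε`.
* `IsAdmissiblePair.exists_surjective` and `IsAdmissiblePair.exists_orbit_bound`: as `HE - ½ G²` is
  bounded below, `G` is a small perturbation of `HE`, so that, as in the Kato–Rellich theorem,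
  `HE + α G` is the full generator of its unitary group. The group therefore preserves the domain of
  `HE`, and `G` stays bounded along its orbits.
* `norm_evolution_sub_le`: by Duhamel's formula the total evolution on a cell is close to a product.
  By orthogonality of the cells this gives the strong convergence in `tendsto_approxEvolution`.
* `exists_hasPartialTrace`: writing the state as `ω = σ²` with a Hilbert–Schmidt operator `σ`, the
  partial trace becomes an absolutely convergent series, in which the discretization can be removed
  by dominated convergence (`tendsto_doubleSum`).
* `norm_proj_mul_mul_proj_le`: unbounded intervals are exhausted by bounded ones.
-/

noncomputable section

namespace InducedSuperselection

/-! ### Hilbert–Schmidt sums -/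

section HilbertSchmidt

variable {E ι : Type*} [NormedAddCommGroup E] [InnerProductSpace ℂ E]

theorem hasSum_norm_inner_sq (b : HilbertBasis ι ℂ E) (x : E) :
    HasSum (fun i => ‖⟪b i, x⟫_ℂ‖ ^ 2) (‖x‖ ^ 2) := by
  have h := Complex.reCLM.hasSum (b.hasSum_inner_mul_inner x x)
  have e : Complex.reCLM ⟪x, x⟫_ℂ = ‖x‖ ^ 2 := by
    rw [Complex.reCLM_apply]; exact inner_self_eq_norm_sq (𝕜 := ℂ) x
  rw [e] at h
  refine h.congr_fun ?_
  intro i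
  rw [← inner_conj_symm x (b i), Complex.conj_mul', Complex.reCLM_apply]
  norm_cast

/-- The matrix entries of a Hilbert–Schmidt operator are square summable. -/
theorem summable_norm_inner_sq (b : HilbertBasis ι ℂ E) {T : E →L[ℂ] E}
    (hT : Summable fun i => ‖T (b i)‖ ^ 2) :
    Summable fun p : ι × ι => ‖⟪b p.2, T (b p.1)⟫_ℂ‖ ^ 2 := by
  rw [summable_prod_of_nonneg fun _ => by positivity]
  refine ⟨fun i => (hasSum_norm_inner_sq b (T (b i))).summable, ?_⟩
  refine hT.congr fun i => ?_
  exact (hasSum_norm_inner_sq b (T (b i))).tsum_eq.symm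

theorem summable_mul_norm_sq (b : ι → E) (X : E →L[ℂ] E) {T : E →L[ℂ] E}
    (hT : Summable fun i => ‖T (b i)‖ ^ 2) : Summable fun i => ‖(X * T) (b i)‖ ^ 2 := by
  refine Summable.of_nonneg_of_le (fun _ => by positivity) (fun i => ?_)
    (hT.mul_left (‖X‖ ^ 2))
  rw [← mul_pow]
  gcongr
  exact X.le_opNorm _

variable [CompleteSpace E]

/-- For Hilbert–Schmidt operators `C` and `D`, the trace of `C† D` equals the trace of `D C†`. -/
theorem hasSum_inner_hilbertSchmidt (b : HilbertBasis ι ℂ E) {C D : E →L[ℂ] E}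
    (hC : Summable fun i => ‖C (b i)‖ ^ 2) (hD : Summable fun i => ‖D (b i)‖ ^ 2) :
    HasSum (fun i => ⟪C (b i), D (b i)⟫_ℂ)
      (∑' j, ⟪ContinuousLinearMap.adjoint D (b j), ContinuousLinearMap.adjoint C (b j)⟫_ℂ) := by
  set a : ι × ι → ℂ := fun p => ⟪C (b p.1), b p.2⟫_ℂ * ⟪b p.2, D (b p.1)⟫_ℂ with ha
  have hs : Summable a := by
    refine Summable.of_norm_bounded
      ((summable_norm_inner_sq b hC).add (summable_norm_inner_sq b hD)) fun p => ?_
    rw [ha, norm_mul, norm_inner_symm]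
    nlinarith [sq_nonneg (‖⟪b p.2, C (b p.1)⟫_ℂ‖ - ‖⟪b p.2, D (b p.1)⟫_ℂ‖),
      sq_nonneg (‖⟪b p.2, C (b p.1)⟫_ℂ‖), sq_nonneg (‖⟪b p.2, D (b p.1)⟫_ℂ‖)]
  have h1 : HasSum (fun i => ⟪C (b i), D (b i)⟫_ℂ) (∑' p, a p) :=
    hs.hasSum.prod_fiberwise fun i => b.hasSum_inner_mul_inner (C (b i)) (D (b i))
  have h2 : HasSum (fun j => ⟪ContinuousLinearMap.adjoint D (b j),
      ContinuousLinearMap.adjoint C (b j)⟫_ℂ) (∑' p, a p) := by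
    have h3 : HasSum (a ∘ (Equiv.prodComm ι ι)) (∑' p, a p) :=
      (Equiv.hasSum_iff _).2 hs.hasSum
    refine h3.prod_fiberwise fun j => ?_
    refine (b.hasSum_inner_mul_inner (ContinuousLinearMap.adjoint D (b j))
      (ContinuousLinearMap.adjoint C (b j))).congr_fun fun i => ?_
    simp only [ha, Function.comp, Equiv.prodComm_apply, Prod.swap_prod_mk,
      ContinuousLinearMap.adjoint_inner_left, ContinuousLinearMap.adjoint_inner_right]
    exact mul_comm _ _
  rwa [h2.tsum_eq]

theorem summable_adjoint_norm_sq (b : HilbertBasis ι ℂ E) {T : E →L[ℂ] E}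
    (hT : Summable fun i => ‖T (b i)‖ ^ 2) :
    Summable fun i => ‖ContinuousLinearMap.adjoint T (b i)‖ ^ 2 := by
  have h := (summable_norm_inner_sq b hT).prod_symm.prod
  refine h.congr fun i => ?_
  rw [← (hasSum_norm_inner_sq b (ContinuousLinearMap.adjoint T (b i))).tsum_eq]
  refine tsum_congr fun j => ?_
  simp only [Prod.swap, ContinuousLinearMap.adjoint_inner_right]
  rw [norm_inner_symm]

/-- A statistical operator is the square of a self-adjoint Hilbert–Schmidt operator of
Hilbert–Schmidt norm one. -/
theorem IsStatisticalOperator.exists_sqrt {ω : E →L[ℂ] E} (hω : IsStatisticalOperator ω) :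
    ∃ σ : E →L[ℂ] E, ContinuousLinearMap.adjoint σ = σ ∧ σ * σ = ω ∧
      HasSum (fun i => ‖σ (basis E i)‖ ^ 2) 1 := by
  have h0 : 0 ≤ ω := (ContinuousLinearMap.nonneg_iff_isPositive ω).2 hω.1
  have hsa : ContinuousLinearMap.adjoint (CFC.sqrt ω) = CFC.sqrt ω :=
    (IsSelfAdjoint.of_nonneg (CFC.sqrt_nonneg ω))
  have hsq := CFC.sqrt_mul_sqrt_self ω h0
  refine ⟨CFC.sqrt ω, hsa, hsq, ?_⟩
  have h := Complex.reCLM.hasSum hω.2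
  rw [Complex.reCLM_apply, Complex.one_re] at h
  refine h.congr_fun fun i => ?_
  have e : ⟪basis E i, ω (basis E i)⟫_ℂ =
      ⟪CFC.sqrt ω (basis E i), CFC.sqrt ω (basis E i)⟫_ℂ := by
    conv_lhs => rw [← hsq, mul_apply_eq_comp]
    rw [← ContinuousLinearMap.adjoint_inner_left, hsa]
  rw [e, Complex.reCLM_apply]
  exact (inner_self_eq_norm_sq (𝕜 := ℂ) _).symm

/-- With `ω = σ²`, the trace of `X ω` is the trace of `σ X σ`, which is absolutely convergent. -/
theorem hasSum_inner_mul_sq (b : HilbertBasis ι ℂ E) {σ : E →L[ℂ] E}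
    (hσ : ContinuousLinearMap.adjoint σ = σ) (hs : Summable fun i => ‖σ (b i)‖ ^ 2)
    (X : E →L[ℂ] E) :
    HasSum (fun i => ⟪b i, X (σ (σ (b i)))⟫_ℂ) (∑' j, ⟪σ (b j), X (σ (b j))⟫_ℂ) := by
  have hC : Summable fun i => ‖(σ * ContinuousLinearMap.adjoint X) (b i)‖ ^ 2 := by
    have h := summable_adjoint_norm_sq b (summable_mul_norm_sq b X hs)
    refine h.congr fun i => ?_
    rw [show ContinuousLinearMap.adjoint (X * σ) = σ * ContinuousLinearMap.adjoint X by
      conv_rhs => rw [← hσ]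
      exact ContinuousLinearMap.adjoint_comp X σ]
  have h := hasSum_inner_hilbertSchmidt b hC hs
  have e : ContinuousLinearMap.adjoint (σ * ContinuousLinearMap.adjoint X) = X * σ := by
    conv_rhs => rw [← hσ]
    refine (ContinuousLinearMap.adjoint_comp σ _).trans ?_
    rw [ContinuousLinearMap.adjoint_adjoint]; rfl
  rw [e, hσ] at h
  refine h.congr_fun fun i => ?_
  rw [mul_apply_eq_comp, ← hσ, ContinuousLinearMap.adjoint_inner_left,
    ContinuousLinearMap.adjoint_inner_left, hσ]

end HilbertSchmidt

/-! ### Simple tensors and the partial trace -/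

section Tensor

variable {E₁ E₂ : Type*} [NormedAddCommGroup E₁] [InnerProductSpace ℂ E₁]
  [NormedAddCommGroup E₂] [InnerProductSpace ℂ E₂]

theorem inner_tmul_tmul (x x' : E₁) (y y' : E₂) :
    ⟪tmul x y, tmul x' y'⟫_ℂ = ⟪x, x'⟫_ℂ * ⟪y, y'⟫_ℂ := by
  simp [tmul, UniformSpace.Completion.inner_coe]

theorem norm_tmul (x : E₁) (y : E₂) : ‖tmul x y‖ = ‖x‖ * ‖y‖ := by
  simp [tmul, UniformSpace.Completion.norm_coe]

variable (E₁ E₂) in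
/-- The bilinear map `(x, y) ↦ x ⊗ y` into the Hilbert space tensor product. -/
def tmulL : E₁ →L[ℂ] E₂ →L[ℂ] HilbertTensor E₁ E₂ :=
  (ContinuousLinearMap.compL ℂ E₂ (E₁ ⊗[ℂ] E₂) (HilbertTensor E₁ E₂)
    UniformSpace.Completion.toComplL).comp (TensorProduct.mkL ℂ E₁ E₂)

@[simp]
theorem tmulL_apply (x : E₁) (y : E₂) : tmulL E₁ E₂ x y = tmul x y := rfl

theorem tmul_add_left (x x' : E₁) (y : E₂) : tmul (x + x') y = tmul x y + tmul x' y := by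
  simp only [← tmulL_apply, map_add, add_apply]

theorem tmul_sub_left (x x' : E₁) (y : E₂) : tmul (x - x') y = tmul x y - tmul x' y := by
  simp only [← tmulL_apply, map_sub, sub_apply]

theorem tmul_add_right (x : E₁) (y y' : E₂) : tmul x (y + y') = tmul x y + tmul x y' := by
  simp only [← tmulL_apply, map_add]

theorem tmul_smul_left (c : ℂ) (x : E₁) (y : E₂) : tmul (c • x) y = c • tmul x y := by
  simp only [← tmulL_apply, map_smul, smul_apply]

theorem tmul_smul_right (c : ℂ) (x : E₁) (y : E₂) : tmul x (c • y) = c • tmul x y := by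
  simp only [← tmulL_apply, map_smul]

theorem tmul_sum_left {ι : Type*} (s : Finset ι) (f : ι → E₁) (y : E₂) :
    tmul (∑ i ∈ s, f i) y = ∑ i ∈ s, tmul (f i) y := by
  simp only [← tmulL_apply, map_sum, sum_apply]

theorem norm_boundedTensor_one_right_le (A : E₁ →L[ℂ] E₁) :
    ‖boundedTensor A (1 : E₂ →L[ℂ] E₂)‖ ≤ ‖A‖ := by
  refine ContinuousLinearMap.opNorm_le_bound _ (norm_nonneg _) fun z => ?_
  induction z using UniformSpace.Completion.induction_on with
  | hp => exact isClosed_le (by fun_prop) (by fun_prop)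
  | ih z =>
    have h : boundedTensor A (1 : E₂ →L[ℂ] E₂) (z : HilbertTensor E₁ E₂) =
        ((TensorProduct.mapL A (1 : E₂ →L[ℂ] E₂) z : E₁ ⊗[ℂ] E₂) : HilbertTensor E₁ E₂) :=
      ContinuousLinearMap.extend_eq _ UniformSpace.Completion.denseRange_coe
        (UniformSpace.Completion.isUniformInducing_coe _) z
    rw [h, UniformSpace.Completion.norm_coe, UniformSpace.Completion.norm_coe]
    refine (ContinuousLinearMap.le_opNorm _ _).trans ?_
    gcongr
    refine (TensorProduct.norm_mapL_le _ _).trans ?_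
    exact mul_le_of_le_one_right (norm_nonneg _) ContinuousLinearMap.norm_id_le

theorem norm_inner_tmul_le (T : HilbertTensor E₁ E₂ →L[ℂ] HilbertTensor E₁ E₂) (f g : E₁)
    (u : E₂) : ‖⟪tmul f u, T (tmul g u)⟫_ℂ‖ ≤ ‖T‖ * ‖f‖ * ‖g‖ * ‖u‖ ^ 2 := by
  refine (norm_inner_le_norm _ _).trans ?_
  have h := T.le_opNorm (tmul g u)
  rw [norm_tmul] at *
  calc ‖f‖ * ‖u‖ * ‖T (tmul g u)‖ ≤ ‖f‖ * ‖u‖ * (‖T‖ * (‖g‖ * ‖u‖)) := by gcongr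
    _ = _ := by ring

variable [CompleteSpace E₂]

/-- The series defining the partial trace of `T (I ⊗ σ²)`, in an absolutely convergent form. -/
theorem hasSum_inner_mul_boundedTensor_sq {σ : E₂ →L[ℂ] E₂}
    (hσ : ContinuousLinearMap.adjoint σ = σ) (hs : Summable fun i => ‖σ (basis E₂ i)‖ ^ 2)
    (T : HilbertTensor E₁ E₂ →L[ℂ] HilbertTensor E₁ E₂) (f g : E₁) :
    HasSum (fun i => ⟪tmul f (basis E₂ i),
        (T * boundedTensor (1 : E₁ →L[ℂ] E₁) (σ * σ) :
          HilbertTensor E₁ E₂ →L[ℂ] HilbertTensor E₁ E₂) (tmul g (basis E₂ i))⟫_ℂ)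
      (∑' j, ⟪tmul f (σ (basis E₂ j)), T (tmul g (σ (basis E₂ j)))⟫_ℂ) := by
  have h := hasSum_inner_mul_sq (basis E₂) hσ hs
    ((ContinuousLinearMap.adjoint (tmulL E₁ E₂ f)).comp (T.comp (tmulL E₁ E₂ g)))
  have e : ∀ u v : E₂, ⟪u, ((ContinuousLinearMap.adjoint (tmulL E₁ E₂ f)).comp
      (T.comp (tmulL E₁ E₂ g))) v⟫_ℂ = ⟪tmul f u, T (tmul g v)⟫_ℂ := fun u v => by
    simp [ContinuousLinearMap.adjoint_inner_right]
  simp only [e] at h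
  refine h.congr_fun fun i => ?_
  rw [mul_apply_eq_comp, boundedTensor_tmul]
  rfl

/-- The partial trace of `T (I ⊗ σ²)` as an absolutely convergent series. -/
theorem HasPartialTrace.inner_eq {σ : E₂ →L[ℂ] E₂} (hσ : ContinuousLinearMap.adjoint σ = σ)
    (hs : Summable fun i => ‖σ (basis E₂ i)‖ ^ 2)
    {T : HilbertTensor E₁ E₂ →L[ℂ] HilbertTensor E₁ E₂} {B : E₁ →L[ℂ] E₁}
    (hB : HasPartialTrace (T * boundedTensor 1 (σ * σ)) B) (f g : E₁) :
    ⟪f, B g⟫_ℂ = ∑' j, ⟪tmul f (σ (basis E₂ j)), T (tmul g (σ (basis E₂ j)))⟫_ℂ :=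
  (hB f g).unique (hasSum_inner_mul_boundedTensor_sq hσ hs T f g)

variable [CompleteSpace E₁]

/-- The partial trace of `T (I ⊗ σ²)` exists when `σ` is a self-adjoint Hilbert–Schmidt operator,
and it is computed by an absolutely convergent series. -/
theorem exists_hasPartialTrace {σ : E₂ →L[ℂ] E₂} (hσ : ContinuousLinearMap.adjoint σ = σ)
    (hs : Summable fun i => ‖σ (basis E₂ i)‖ ^ 2)
    (T : HilbertTensor E₁ E₂ →L[ℂ] HilbertTensor E₁ E₂) :
    ∃ B : E₁ →L[ℂ] E₁, HasPartialTrace (T * boundedTensor 1 (σ * σ)) B := by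
  set φ : E₁ → E₁ → ℂ := fun f g =>
    ∑' j, ⟪tmul f (σ (basis E₂ j)), T (tmul g (σ (basis E₂ j)))⟫_ℂ with hφ
  have hsum : ∀ f g, Summable fun j =>
      ⟪tmul f (σ (basis E₂ j)), T (tmul g (σ (basis E₂ j)))⟫_ℂ := fun f g =>
    Summable.of_norm_bounded (hs.mul_left (‖T‖ * ‖f‖ * ‖g‖)) fun j => norm_inner_tmul_le T f g _
  have hbound : ∀ f g, ‖φ f g‖ ≤ (‖T‖ * ∑' j, ‖σ (basis E₂ j)‖ ^ 2) * ‖f‖ * ‖g‖ := fun f g => by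
    refine (tsum_of_norm_bounded (hs.hasSum.mul_left (‖T‖ * ‖f‖ * ‖g‖))
      fun j => norm_inner_tmul_le T f g _).trans (le_of_eq ?_)
    ring
  let Φ : E₁ →L⋆[ℂ] E₁ →L[ℂ] ℂ := LinearMap.mkContinuous₂
    (LinearMap.mk₂'ₛₗ (starRingEnd ℂ) (RingHom.id ℂ) φ
      (fun f f' g => by
        simp only [hφ, tmul_add_left, inner_add_left]
        exact (hsum f g).tsum_add (hsum f' g))
      (fun c f g => by
        simp only [hφ, tmul_smul_left, inner_smul_left]
        exact tsum_mul_left)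
      (fun f g g' => by
        simp only [hφ, tmul_add_left, map_add, inner_add_right]
        exact (hsum f g).tsum_add (hsum f g'))
      (fun c f g => by
        simp only [hφ, tmul_smul_left, map_smul, inner_smul_right]
        exact tsum_mul_left)) _ hbound
  refine ⟨ContinuousLinearMap.adjoint (InnerProductSpace.continuousLinearMapOfBilin Φ),
    fun f g => ?_⟩
  rw [ContinuousLinearMap.adjoint_inner_right, InnerProductSpace.continuousLinearMapOfBilin_apply]
  exact hasSum_inner_mul_boundedTensor_sq hσ hs T f g

end Tensor

/-! ### Spectral subspaces of a self-adjoint operator -/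

section Symmetric

variable {E : Type*} [NormedAddCommGroup E] [InnerProductSpace ℂ E] [CompleteSpace E]

theorem inner_apply_eq_of_isSelfAdjoint {A : E →ₗ.[ℂ] E} (hA : IsSelfAdjoint A)
    (x y : A.domain) : ⟪A x, (y : E)⟫_ℂ = ⟪(x : E), A y⟫_ℂ := by
  have h := LinearPMap.adjoint_isFormalAdjoint hA.dense_domain
  rw [LinearPMap.isSelfAdjoint_def.1 hA] at h
  exact h x y

end Symmetric

namespace ProjectionMeasure

open MeasureTheory Filter Topology

variable {E : Type*} [NormedAddCommGroup E] [InnerProductSpace ℂ E] [CompleteSpace E]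
  (P : ProjectionMeasure E) {s t I : Set ℝ}

theorem measure_apply (x : E) (hs : MeasurableSet s) :
    P.measure x s = ENNReal.ofReal (‖P.proj s x‖ ^ 2) :=
  Measure.ofMeasurable_apply s hs

theorem proj_proj (hs : MeasurableSet s) (ht : MeasurableSet t) (x : E) :
    P.proj s (P.proj t x) = P.proj (s ∩ t) x := by
  rw [P.inter s t hs ht]; rfl

theorem inner_proj_left (hs : MeasurableSet s) (x y : E) :
    ⟪P.proj s x, y⟫_ℂ = ⟪x, P.proj s y⟫_ℂ := by
  have h : ContinuousLinearMap.adjoint (P.proj s) = P.proj s :=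
    (P.isStarProjection s hs).isSelfAdjoint
  rw [← ContinuousLinearMap.adjoint_inner_right, h]

theorem norm_proj_le (hs : MeasurableSet s) (x : E) : ‖P.proj s x‖ ≤ ‖x‖ := by
  have h := (re_inner_le_norm (𝕜 := ℂ) x (P.proj s x))
  have h2 := P.norm_sq_eq hs x
  have h3 : ‖P.proj s x‖ ^ 2 ≤ ‖x‖ * ‖P.proj s x‖ := h2.trans_le h
  by_contra! hlt
  nlinarith [norm_nonneg x]

theorem norm_sub_proj_sq (hs : MeasurableSet s) (x : E) :
    ‖x - P.proj s x‖ ^ 2 = ‖x‖ ^ 2 - ‖P.proj s x‖ ^ 2 := by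
  rw [norm_sub_sq (𝕜 := ℂ), P.norm_sq_eq hs x]
  simp only [RCLike.re_to_complex]
  ring


theorem measure_univ (x : E) : P.measure x Set.univ = ENNReal.ofReal (‖x‖ ^ 2) := by
  rw [P.measure_apply x MeasurableSet.univ, P.univ]; rfl

instance (x : E) : IsFiniteMeasure (P.measure x) :=
  ⟨by rw [P.measure_univ]; exact ENNReal.ofReal_lt_top⟩

theorem measureReal_univ (x : E) : (P.measure x).real Set.univ = ‖x‖ ^ 2 := by
  rw [Measure.real, P.measure_univ, ENNReal.toReal_ofReal (by positivity)]

theorem measure_compl_eq_zero (hI : MeasurableSet I) {x : E} (hx : P.proj I x = x) :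
    P.measure x Iᶜ = 0 := by
  rw [P.measure_apply x hI.compl, ← hx, P.proj_proj hI.compl hI, Set.compl_inter_self, P.empty]
  simp

theorem ae_mem (hI : MeasurableSet I) {x : E} (hx : P.proj I x = x) :
    ∀ᵐ l ∂(P.measure x), l ∈ I :=
  P.measure_compl_eq_zero hI hx

theorem measure_neg (x : E) : P.measure (-x) = P.measure x := by
  ext s hs
  simp [P.measure_apply _ hs]

/-- The spectral measures of vectors from complementary spectral subspaces add up. -/
theorem measure_add (hI : MeasurableSet I) {x z : E} (hx : P.proj I x = x)
    (hz : P.proj I z = 0) : P.measure (x + z) = P.measure x + P.measure z := by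
  ext s hs
  rw [Measure.add_apply, P.measure_apply _ hs, P.measure_apply _ hs, P.measure_apply _ hs,
    ← ENNReal.ofReal_add (by positivity) (by positivity), map_add]
  congr 1
  have h : ⟪P.proj s x, P.proj s z⟫_ℂ = 0 := by
    rw [← hx, P.proj_proj hs hI, Set.inter_comm, ← P.proj_proj hI hs, P.inner_proj_left hI,
      P.proj_proj hI hs, Set.inter_comm, ← P.proj_proj hs hI, hz, map_zero, inner_zero_right]
  have h2 := norm_add_sq_eq_norm_sq_add_norm_sq_of_inner_eq_zero _ _ h
  simpa only [sq] using h2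

/-- The spectral subspaces of an exhausting sequence of sets exhaust the Hilbert space. -/
theorem tendsto_proj (s : ℕ → Set ℝ) (hs : ∀ n, MeasurableSet (s n)) (hmono : Monotone s)
    (hU : ⋃ n, s n = Set.univ) (x : E) :
    Tendsto (fun n => P.proj (s n) x) atTop (𝓝 x) := by
  have h1 : Tendsto (fun n => ‖P.proj (s n) x‖ ^ 2) atTop (𝓝 (‖x‖ ^ 2)) := by
    have h := tendsto_measure_iUnion_atTop (μ := P.measure x) hmono
    rw [hU, P.measure_univ] at h
    have h' := (ENNReal.tendsto_toReal ENNReal.ofReal_ne_top).comp h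
    rw [ENNReal.toReal_ofReal (by positivity)] at h'
    refine h'.congr fun n => ?_
    rw [Function.comp, Function.comp, P.measure_apply x (hs n),
      ENNReal.toReal_ofReal (by positivity)]
  rw [tendsto_iff_norm_sub_tendsto_zero]
  have h2 : Tendsto (fun n => √(‖x‖ ^ 2 - ‖P.proj (s n) x‖ ^ 2)) atTop (𝓝 0) := by
    have e : √(‖x‖ ^ 2 - ‖x‖ ^ 2) = 0 := by simp
    rw [← e]
    exact (h1.const_sub (‖x‖ ^ 2)).sqrt
  refine h2.congr fun n => ?_
  rw [← P.norm_sub_proj_sq (hs n), Real.sqrt_sq (norm_nonneg _), norm_sub_rev]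

end ProjectionMeasure

namespace IsSpectralMeasure

open MeasureTheory

variable {E : Type*} [NormedAddCommGroup E] [InnerProductSpace ℂ E] [CompleteSpace E]
  {F : E →ₗ.[ℂ] E} {P : ProjectionMeasure E} {I : Set ℝ} {α ε : ℝ}

theorem mem_domain (hF : IsSpectralMeasure F P) (hI : MeasurableSet I)
    (hε : ∀ l ∈ I, |l - α| ≤ ε) {x : E} (hx : P.proj I x = x) : x ∈ F.domain := by
  rw [hF.mem_domain_iff]
  refine (lintegral_mono_ae (g := fun _ => ENNReal.ofReal ((|α| + ε) ^ 2)) ?_).trans_lt ?_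
  · filter_upwards [P.ae_mem hI hx] with l hl
    refine ENNReal.ofReal_le_ofReal (sq_le_sq' ?_ ?_) <;>
    linarith [abs_le.1 (hε l hl), neg_abs_le α, le_abs_self α, (abs_nonneg (l - α))]
  · rw [lintegral_const]
    exact ENNReal.mul_lt_top ENNReal.ofReal_lt_top (measure_lt_top _ _)

theorem integrable (hF : IsSpectralMeasure F P) {x : E} (hx : x ∈ F.domain) :
    Integrable (fun l : ℝ => l) (P.measure x) := by
  have h2 : Integrable (fun l : ℝ => l ^ 2) (P.measure x) :=
    ⟨by fun_prop, by
      rw [hasFiniteIntegral_iff_ofReal (Filter.Eventually.of_forall fun l => sq_nonneg l)]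
      exact (hF.mem_domain_iff x).1 hx⟩
  refine ((integrable_const (1 : ℝ)).add h2).mono' (by fun_prop)
    (Filter.Eventually.of_forall fun l => ?_)
  rw [Real.norm_eq_abs, Pi.add_apply]
  nlinarith [sq_abs l, sq_nonneg (|l| - 1), sq_nonneg l]

theorem abs_integral_sub_le (hI : MeasurableSet I) (hε : ∀ l ∈ I, |l - α| ≤ ε)
    {x : E} (hx : P.proj I x = x) (hint : Integrable (fun l : ℝ => l) (P.measure x)) :
    |(∫ l, l ∂(P.measure x)) - α * ‖x‖ ^ 2| ≤ ε * ‖x‖ ^ 2 := by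
  have h1 : (∫ l, l ∂(P.measure x)) - α * ‖x‖ ^ 2 = ∫ l, (l - α) ∂(P.measure x) := by
    rw [integral_sub hint (integrable_const α), integral_const, P.measureReal_univ, smul_eq_mul,
      mul_comm]
  rw [h1, ← P.measureReal_univ]
  refine norm_integral_le_of_norm_le_const (f := fun l : ℝ => l - α) (C := ε) ?_
  filter_upwards [P.ae_mem hI hx] with l hl using hε l hl

/-- On the spectral subspace of a set within distance `ε` of `α`, the operator `F` differs from `α`
by at most `ε`. By polarization this follows from the bound on the quadratic form of `F - α`: for an
arbitrary vector `y` the part of `y` orthogonal to the spectral subspace contributes the same to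
the quadratic forms at `x + y` and `x - y`. -/
theorem norm_apply_sub_le (hF : IsSpectralMeasure F P) (hsa : IsSelfAdjoint F)
    (hI : MeasurableSet I) (hε0 : 0 < ε) (hε : ∀ l ∈ I, |l - α| ≤ ε) (x : F.domain)
    (hx : P.proj I (x : E) = x) : ‖F x - (α : ℂ) • (x : E)‖ ≤ ε * ‖(x : E)‖ := by
  set v : E := F x - (α : ℂ) • (x : E) with hv
  have hq : ∀ u : F.domain, (⟪(u : E), F u⟫_ℂ).re = ∫ l, l ∂(P.measure (u : E)) := fun u => by
    rw [hF.inner_apply u, Complex.ofReal_re]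
  have key : ∀ y : E, (⟪y, v⟫_ℂ).re ≤ ε / 2 * (‖(x : E)‖ ^ 2 + ‖y‖ ^ 2) := by
    intro y
    refine hsa.dense_domain.induction (P := fun y => (⟪y, v⟫_ℂ).re ≤
      ε / 2 * (‖(x : E)‖ ^ 2 + ‖y‖ ^ 2)) (fun y hy => ?_)
      (isClosed_le (by fun_prop) (by fun_prop)) y
    set z := P.proj I y with hz
    have hzz : P.proj I z = z := by rw [hz, P.proj_proj hI hI, Set.inter_self]
    have hzD : z ∈ F.domain := hF.mem_domain hI hε hzz
    set w := y - z with hw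
    have hw0 : P.proj I w = 0 := by rw [hw, map_sub, hzz, ← hz, sub_self]
    have hwD : w ∈ F.domain := F.domain.sub_mem hy hzD
    have hyzw : y = z + w := by rw [hw]; abel
    let Y : F.domain := ⟨y, hy⟩
    have hp : P.proj I ((x : E) + z) = (x : E) + z := by rw [map_add, hx, hzz]
    have hm : P.proj I ((x : E) - z) = (x : E) - z := by rw [map_sub, hx, hzz]
    have hpD : (x : E) + z ∈ F.domain := F.domain.add_mem x.2 hzD
    have hmD : (x : E) - z ∈ F.domain := F.domain.sub_mem x.2 hzD
    have e1 : ∫ l, l ∂(P.measure ((x + Y : F.domain) : E)) =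
        (∫ l, l ∂(P.measure ((x : E) + z))) + ∫ l, l ∂(P.measure w) := by
      rw [← integral_add_measure (hF.integrable hpD) (hF.integrable hwD),
        ← P.measure_add hI hp hw0, Submodule.coe_add]
      congr 2
      change (x : E) + y = _
      rw [hyzw]; abel
    have e2 : ∫ l, l ∂(P.measure ((x - Y : F.domain) : E)) =
        (∫ l, l ∂(P.measure ((x : E) - z))) + ∫ l, l ∂(P.measure w) := by
      rw [← P.measure_neg w, ← integral_add_measure (hF.integrable hmD)
        (by rw [P.measure_neg]; exact hF.integrable hwD),
        ← P.measure_add hI hm (by rw [map_neg, hw0, neg_zero]), Submodule.coe_sub]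
      congr 2
      change (x : E) - y = _
      rw [hyzw]; abel
    have b1 := abs_le.1 (abs_integral_sub_le hI hε hp (hF.integrable hpD))
    have b2 := abs_le.1 (abs_integral_sub_le hI hε hm (hF.integrable hmD))
    have hxz := parallelogram_law_with_norm ℂ (x : E) z
    have hxz2 : ‖(x : E) + z‖ ^ 2 - ‖(x : E) - z‖ ^ 2 = 4 * (⟪z, (x : E)⟫_ℂ).re := by
      rw [norm_add_sq (𝕜 := ℂ), norm_sub_sq (𝕜 := ℂ), inner_re_symm]
      simp only [RCLike.re_to_complex]; ring
    have hzx : ⟪y, (x : E)⟫_ℂ = ⟪z, (x : E)⟫_ℂ := by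
      rw [hz, P.inner_proj_left hI, hx]
    have hpol : (⟪((x + Y : F.domain) : E), F (x + Y)⟫_ℂ).re -
        (⟪((x - Y : F.domain) : E), F (x - Y)⟫_ℂ).re = 4 * (⟪y, F x⟫_ℂ).re := by
      rw [F.map_add, F.map_sub, Submodule.coe_add, Submodule.coe_sub]
      have h1 : (⟪(x : E), F Y⟫_ℂ).re = (⟪y, F x⟫_ℂ).re := by
        rw [← inner_apply_eq_of_isSelfAdjoint hsa x Y]
        exact inner_re_symm (𝕜 := ℂ) _ _
      simp only [inner_add_left, inner_add_right, inner_sub_left, inner_sub_right,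
        Complex.add_re, Complex.sub_re, h1]
      change _ + _ + (_ + (⟪y, F Y⟫_ℂ).re) - _ = _
      simp only [Y]
      ring
    rw [hq, hq, e1, e2] at hpol
    have hfin : (⟪y, v⟫_ℂ).re = (⟪y, F x⟫_ℂ).re - α * (⟪z, (x : E)⟫_ℂ).re := by
      rw [hv, inner_sub_right, inner_smul_right, hzx, Complex.sub_re, Complex.re_ofReal_mul]
    have hzy := P.norm_proj_le hI y
    have hzy2 : ‖z‖ ^ 2 ≤ ‖y‖ ^ 2 := by gcongr
    rw [hfin]
    have hpar : ‖(x : E) + z‖ ^ 2 + ‖(x : E) - z‖ ^ 2 = 2 * (‖(x : E)‖ ^ 2 + ‖z‖ ^ 2) := by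
      simpa only [sq] using hxz
    have hmul := mul_le_mul_of_nonneg_left hzy2 hε0.le
    have hpar' : ε * ‖(x : E) + z‖ ^ 2 + ε * ‖(x : E) - z‖ ^ 2 =
        2 * (ε * ‖(x : E)‖ ^ 2 + ε * ‖z‖ ^ 2) := by rw [← mul_add, hpar]; ring
    have hxz2' : α * ‖(x : E) + z‖ ^ 2 - α * ‖(x : E) - z‖ ^ 2 =
        4 * (α * (⟪z, (x : E)⟫_ℂ).re) := by rw [← mul_sub, hxz2]; ring
    linarith [b1.2, b2.1]
  -- the choice of `y` which optimizes the bound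
  have h := key (((1 / ε : ℝ) : ℂ) • v)
  rw [inner_smul_left, Complex.conj_ofReal, Complex.re_ofReal_mul, norm_smul, Complex.norm_real,
    Real.norm_of_nonneg (by positivity)] at h
  have hvv : (⟪v, v⟫_ℂ).re = ‖v‖ ^ 2 := inner_self_eq_norm_sq (𝕜 := ℂ) v
  rw [hvv] at h
  have h3 : ‖v‖ ^ 2 ≤ (ε * ‖(x : E)‖) ^ 2 := by
    have h4 := mul_le_mul_of_nonneg_left h (by positivity : (0 : ℝ) ≤ 2 * ε)
    have h5 : 2 * ε * (1 / ε * ‖v‖ ^ 2) = 2 * ‖v‖ ^ 2 := by field_simp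
    have h6 : 2 * ε * (ε / 2 * (‖(x : E)‖ ^ 2 + (1 / ε * ‖v‖) ^ 2)) =
        (ε * ‖(x : E)‖) ^ 2 + ‖v‖ ^ 2 := by field_simp
    linarith
  exact (pow_le_pow_iff_left₀ (norm_nonneg _) (by positivity) two_ne_zero).1 h3

end IsSpectralMeasure

/-! ### The perturbed Hamiltonians and their unitary groups -/

section Range

variable {E : Type*} [NormedAddCommGroup E] [InnerProductSpace ℂ E] [CompleteSpace E]
  {A : E →ₗ.[ℂ] E}

/-- A linear map on the domain of a closed operator `A` has closed range if its norm is equivalent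
to the graph norm of `A`. -/
theorem isClosed_range_of_graph_bounds (hA : A.IsClosed) (T : A.domain →ₗ[ℂ] E) {c C : ℝ}
    (h1 : ∀ y : A.domain, ‖(y : E)‖ ≤ c * ‖T y‖) (h2 : ∀ y, ‖A y‖ ≤ c * ‖T y‖)
    (h3 : ∀ y, ‖T y‖ ≤ C * (‖A y‖ + ‖(y : E)‖)) :
    IsClosed (LinearMap.range T : Set E) := by
  have : CompleteSpace A.graph := IsClosed.completeSpace_coe (hs := hA)
  let π : A.graph →ₗ[ℂ] A.domain :=
    ((LinearMap.fst ℂ E E).comp A.graph.subtype).codRestrict A.domain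
      fun p => LinearPMap.mem_domain_of_mem_graph p.2
  have hπ : ∀ p : A.graph, A (π p) = (p : E × E).2 := fun p => by
    obtain ⟨y, hy1, hy2⟩ := (LinearPMap.mem_graph_iff A).1 p.2
    rw [← hy2]
    congr 1
    exact Subtype.ext hy1.symm
  have hanti : AntilipschitzWith c.toNNReal (T.comp π) := by
    refine AddMonoidHomClass.antilipschitz_of_bound (T.comp π) fun p => ?_
    have hc : c * ‖T (π p)‖ ≤ c.toNNReal * ‖T (π p)‖ := by
      gcongr; exact Real.le_coe_toNNReal c
    refine max_le ((h1 (π p)).trans hc) ?_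
    change ‖(p : E × E).2‖ ≤ _
    rw [← hπ p]
    exact (h2 (π p)).trans hc
  have hcont : UniformContinuous (T.comp π) := by
    refine AddMonoidHomClass.uniformContinuous_of_bound (T.comp π) (|C| * 2) fun p => ?_
    refine (h3 (π p)).trans ?_
    have e1 : ‖A (π p)‖ ≤ ‖p‖ := by rw [hπ p]; exact norm_snd_le (p : E × E)
    have e2 : ‖((π p : A.domain) : E)‖ ≤ ‖p‖ := norm_fst_le (p : E × E)
    calc C * (‖A (π p)‖ + ‖((π p : A.domain) : E)‖)
        ≤ |C| * (‖A (π p)‖ + ‖((π p : A.domain) : E)‖) := by gcongr; exact le_abs_self C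
      _ ≤ |C| * (‖p‖ + ‖p‖) := by gcongr
      _ = |C| * 2 * ‖p‖ := by ring
  have h := hanti.isClosed_range hcont
  convert h using 1
  ext z
  constructor
  · rintro ⟨y, rfl⟩
    exact ⟨⟨((y : E), A y), A.mem_graph y⟩, rfl⟩
  · rintro ⟨p, rfl⟩
    exact ⟨π p, rfl⟩

theorem surjective_of_isClosed_range {D : Type*} [AddCommGroup D] [Module ℂ D] (T : D →ₗ[ℂ] E)
    (hT : IsClosed (LinearMap.range T : Set E)) (h : ∀ w : E, (∀ y, ⟪w, T y⟫_ℂ = 0) → w = 0) :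
    Function.Surjective T := by
  rw [← LinearMap.range_eq_top, ← hT.submodule_topologicalClosure_eq,
    Submodule.topologicalClosure_eq_top_iff, Submodule.eq_bot_iff]
  intro w hw
  refine h w fun y => ?_
  exact (Submodule.mem_orthogonal' _ w).1 hw _ ⟨y, rfl⟩

theorem mem_domain_of_inner_eq (hA : IsSelfAdjoint A) {w w' : E}
    (h : ∀ y : A.domain, ⟪w', (y : E)⟫_ℂ = ⟪w, A y⟫_ℂ) :
    ∃ hw : w ∈ A.domain, A ⟨w, hw⟩ = w' := by
  have key : ∃ hw : w ∈ A.adjoint.domain, A.adjoint ⟨w, hw⟩ = w' :=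
    ⟨LinearPMap.mem_adjoint_domain_of_exists w ⟨w', h⟩,
      LinearPMap.adjoint_apply_eq hA.dense_domain _ h⟩
  rwa [LinearPMap.isSelfAdjoint_def.1 hA] at key

theorem im_inner_apply_self (hA : IsSelfAdjoint A) (y : A.domain) :
    (⟪(y : E), A y⟫_ℂ).im = 0 := by
  have h := inner_apply_eq_of_isSelfAdjoint hA y y
  rw [← inner_conj_symm, Complex.conj_eq_iff_im] at h
  exact h

theorem norm_apply_add_I_smul_sq (hA : IsSelfAdjoint A) (μ : ℝ) (y : A.domain) :
    ‖A y + (Complex.I * μ) • (y : E)‖ ^ 2 = ‖A y‖ ^ 2 + μ ^ 2 * ‖(y : E)‖ ^ 2 := by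
  have h : (⟪A y, (Complex.I * μ) • (y : E)⟫_ℂ).re = 0 := by
    rw [inner_smul_right, inner_apply_eq_of_isSelfAdjoint hA]
    simp [im_inner_apply_self hA y]
  rw [norm_add_sq (𝕜 := ℂ), RCLike.re_to_complex, h, norm_smul]
  simp [mul_pow]

theorem norm_apply_le_norm_add_I_smul (hA : IsSelfAdjoint A) (μ : ℝ) (y : A.domain) :
    ‖A y‖ ≤ ‖A y + (Complex.I * μ) • (y : E)‖ := by
  refine (pow_le_pow_iff_left₀ (norm_nonneg _) (norm_nonneg _) two_ne_zero).1 ?_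
  rw [norm_apply_add_I_smul_sq hA]
  nlinarith [mul_nonneg (sq_nonneg μ) (sq_nonneg ‖(y : E)‖)]

theorem mul_norm_le_norm_add_I_smul (hA : IsSelfAdjoint A) {μ : ℝ} (hμ : 0 ≤ μ) (y : A.domain) :
    μ * ‖(y : E)‖ ≤ ‖A y + (Complex.I * μ) • (y : E)‖ := by
  refine (pow_le_pow_iff_left₀ (by positivity) (norm_nonneg _) two_ne_zero).1 ?_
  rw [norm_apply_add_I_smul_sq hA, mul_pow]
  nlinarith [sq_nonneg ‖A y‖]

/-- The map `y ↦ A y + i μ y` is onto for self-adjoint `A`: its range is closed, and a vector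
orthogonal to the range would be an eigenvector of `A` with eigenvalue `i μ`. -/
theorem surjective_add_I_smul (hA : IsSelfAdjoint A) {μ : ℝ} (hμ : 0 < μ) :
    Function.Surjective (A.toFun + (Complex.I * μ) • A.domain.subtype) := by
  set T := A.toFun + (Complex.I * μ) • A.domain.subtype with hT
  have hTy : ∀ y, T y = A y + (Complex.I * μ) • (y : E) := fun y => rfl
  have hA1 : ∀ y, ‖A y‖ ≤ ‖T y‖ := norm_apply_le_norm_add_I_smul hA μ
  have hy1 : ∀ y : A.domain, μ * ‖(y : E)‖ ≤ ‖T y‖ := mul_norm_le_norm_add_I_smul hA hμ.le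
  refine surjective_of_isClosed_range T
    (isClosed_range_of_graph_bounds (c := 1 + 1 / μ) (C := 1 + μ) hA.isClosed T ?_ ?_ ?_) ?_
  · intro y
    calc ‖(y : E)‖ = 1 / μ * (μ * ‖(y : E)‖) := by field_simp
      _ ≤ 1 / μ * ‖T y‖ := by gcongr; exact hy1 y
      _ ≤ (1 + 1 / μ) * ‖T y‖ := by gcongr; linarith
  · intro y
    calc ‖A y‖ ≤ 1 * ‖T y‖ := by rw [one_mul]; exact hA1 y
      _ ≤ (1 + 1 / μ) * ‖T y‖ := by gcongr; linarith [(by positivity : 0 < 1 / μ)]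
  · intro y
    rw [hTy]
    refine (norm_add_le _ _).trans ?_
    rw [norm_smul, norm_mul, Complex.norm_I, Complex.norm_real, Real.norm_of_nonneg hμ.le]
    nlinarith [norm_nonneg (A y), norm_nonneg (y : E), mul_nonneg hμ.le (norm_nonneg (A y))]
  · intro w hw
    obtain ⟨hwD, hAw⟩ := mem_domain_of_inner_eq hA (w := w) (w' := (Complex.I * μ) • w) fun y => by
      have h := hw y
      rw [hTy, inner_add_right, inner_smul_right] at h
      rw [inner_smul_left, map_mul, Complex.conj_I, Complex.conj_ofReal]
      linear_combination -h
    have h := hw ⟨w, hwD⟩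
    rw [hTy, hAw, ← add_smul, inner_smul_right] at h
    have hne : Complex.I * μ + Complex.I * μ ≠ 0 := by
      rw [← two_mul]
      simp [hμ.ne']
    exact inner_self_eq_zero.1 ((mul_eq_zero.1 h).resolve_left hne)

end Range

namespace IsAdmissiblePair

variable {E : Type*} [NormedAddCommGroup E] [InnerProductSpace ℂ E] [CompleteSpace E]
  {H G : E →ₗ.[ℂ] E}

theorem domain_le_right (h : IsAdmissiblePair H G) : H.domain ≤ G.domain :=
  fun _ hx => (h.domain_le hx).1

/-- The form bound on `G` that results from `H - ½ G²` being bounded below. -/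
theorem exists_norm_sq_le (h : IsAdmissiblePair H G) :
    ∃ m : ℝ, 0 ≤ m ∧ ∀ (x : E) (hx : x ∈ H.domain), ‖G ⟨x, h.domain_le_right hx⟩‖ ^ 2 ≤
      2 * (⟪x, H ⟨x, hx⟩⟫_ℂ).re + m * ‖x‖ ^ 2 := by
  obtain ⟨m, hm⟩ := h.semibounded
  refine ⟨2 * |m|, by positivity, fun x hx => ?_⟩
  have h1 := hm x hx
  have h2 : (⟪x, square G ⟨x, h.domain_le hx⟩⟫_ℂ).re = ‖G ⟨x, h.domain_le_right hx⟩‖ ^ 2 := by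
    rw [← inner_self_eq_norm_sq (𝕜 := ℂ)]
    exact congrArg Complex.re (inner_apply_eq_of_isSelfAdjoint h.selfAdjoint_right
      ⟨x, h.domain_le_right hx⟩ ⟨G ⟨x, h.domain_le_right hx⟩, (h.domain_le hx).2⟩).symm
  rw [h2] at h1
  nlinarith [mul_le_mul_of_nonneg_right (neg_abs_le m) (sq_nonneg ‖x‖)]

/-- A Kato–Rellich type statement: for large `μ` the map `y ↦ (H + α G) y + i μ y` is onto. The
form bound on `G` makes `α G` small relative to `H + i μ`, so that the range stays closed and
nothing nonzero is orthogonal to it. -/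
theorem exists_surjective (h : IsAdmissiblePair H G) (α : ℝ) :
    ∃ μ : ℝ, 0 < μ ∧ ∀ z : E, ∃ y : (H + (α : ℂ) • G).domain,
      (H + (α : ℂ) • G) y + (Complex.I * μ) • (y : E) = z := by
  obtain ⟨m, hm0, hm⟩ := h.exists_norm_sq_le
  have hA := h.selfAdjoint_left
  -- chosen so that `‖α G y‖ ≤ ½ ‖(H + i μ) y‖`
  set μ : ℝ := 1 + 4 * α ^ 2 * (2 + m) with hμdef
  have hμ1 : 1 ≤ μ := by
    have : 0 ≤ 4 * α ^ 2 * (2 + m) := by positivity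
    linarith
  have hμ : 0 < μ := by linarith
  refine ⟨μ, hμ, ?_⟩
  set T₁ := H.toFun + (Complex.I * μ) • H.domain.subtype with hT₁
  have hT₁y : ∀ y, T₁ y = H y + (Complex.I * μ) • (y : E) := fun y => rfl
  set B : H.domain →ₗ[ℂ] E := (α : ℂ) • (G.toFun.comp (Submodule.inclusion h.domain_le_right))
    with hB
  have hBy : ∀ y : H.domain, B y = (α : ℂ) • G ⟨(y : E), h.domain_le_right y.2⟩ := fun y => rfl
  have hA1 : ∀ y, ‖H y‖ ≤ ‖T₁ y‖ := norm_apply_le_norm_add_I_smul hA μ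
  have hy1 : ∀ y : H.domain, μ * ‖(y : E)‖ ≤ ‖T₁ y‖ := mul_norm_le_norm_add_I_smul hA hμ.le
  have hy2 : ∀ y : H.domain, ‖(y : E)‖ ≤ ‖T₁ y‖ := fun y =>
    le_trans (by nlinarith [norm_nonneg (y : E)]) (hy1 y)
  have hBsmall : ∀ y, ‖B y‖ ≤ 1 / 2 * ‖T₁ y‖ := fun y => by
    refine (pow_le_pow_iff_left₀ (norm_nonneg _) (by positivity) two_ne_zero).1 ?_
    rw [hBy, norm_smul, Complex.norm_real, Real.norm_eq_abs, mul_pow, sq_abs, mul_pow]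
    have h1 := hm y y.2
    have h2 : (⟪(y : E), H y⟫_ℂ).re ≤ ‖(y : E)‖ * ‖T₁ y‖ :=
      (re_inner_le_norm (𝕜 := ℂ) _ _).trans (by gcongr; exact hA1 y)
    have h3 : ‖G ⟨(y : E), h.domain_le_right y.2⟩‖ ^ 2 ≤ (2 + m) * (‖(y : E)‖ * ‖T₁ y‖) := by
      have h4 : m * ‖(y : E)‖ ^ 2 ≤ m * (‖(y : E)‖ * ‖T₁ y‖) := by
        rw [sq]; gcongr; exact hy2 y
      refine h1.trans ?_
      linarith
    have h5 : 4 * α ^ 2 * (2 + m) * ‖(y : E)‖ ≤ ‖T₁ y‖ :=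
      le_trans (by gcongr; linarith) (hy1 y)
    calc α ^ 2 * ‖G ⟨(y : E), h.domain_le_right y.2⟩‖ ^ 2
        ≤ α ^ 2 * ((2 + m) * (‖(y : E)‖ * ‖T₁ y‖)) := by gcongr
      _ = 1 / 4 * ((4 * α ^ 2 * (2 + m) * ‖(y : E)‖) * ‖T₁ y‖) := by ring
      _ ≤ 1 / 4 * (‖T₁ y‖ * ‖T₁ y‖) := by gcongr
      _ = _ := by ring
  have hlow : ∀ y, ‖T₁ y‖ ≤ 2 * ‖(T₁ + B) y‖ := fun y => by
    have h1 : ‖T₁ y‖ ≤ ‖(T₁ + B) y‖ + ‖B y‖ := by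
      have := norm_sub_le ((T₁ + B) y) (B y)
      rwa [LinearMap.add_apply, add_sub_cancel_right] at this
    linarith [hBsmall y]
  have hsurj : Function.Surjective (T₁ + B) := by
    refine surjective_of_isClosed_range _
      (isClosed_range_of_graph_bounds (c := 2) (C := 2 * (1 + μ)) hA.isClosed _ ?_ ?_ ?_) ?_
    · exact fun y => (hy2 y).trans (hlow y)
    · exact fun y => (hA1 y).trans (hlow y)
    · intro y
      have h1 : ‖T₁ y‖ ≤ ‖H y‖ + μ * ‖(y : E)‖ := by
        rw [hT₁y]
        refine (norm_add_le _ _).trans ?_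
        rw [norm_smul, norm_mul, Complex.norm_I, Complex.norm_real, Real.norm_of_nonneg hμ.le,
          one_mul]
      have h2 := norm_add_le (T₁ y) (B y)
      rw [LinearMap.add_apply]
      nlinarith [hBsmall y, norm_nonneg (H y), norm_nonneg (y : E),
        mul_nonneg hμ.le (norm_nonneg (H y))]
    · intro w hw
      -- a vector `w = (H + i μ) y` orthogonal to the range is orthogonal to `w + α G y`
      obtain ⟨y, rfl⟩ := surjective_add_I_smul hA hμ w
      change T₁ y = 0
      have h1 : ⟪T₁ y, T₁ y + B y⟫_ℂ = 0 := hw y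
      rw [inner_add_right] at h1
      have h2 : ‖T₁ y‖ ^ 2 = -(⟪T₁ y, B y⟫_ℂ).re := by
        have h3 := congrArg Complex.re h1
        rw [Complex.add_re, Complex.zero_re] at h3
        have h4 : (⟪T₁ y, T₁ y⟫_ℂ).re = ‖T₁ y‖ ^ 2 := inner_self_eq_norm_sq (𝕜 := ℂ) _
        linarith
      have h5 : -(⟪T₁ y, B y⟫_ℂ).re ≤ ‖T₁ y‖ * ‖B y‖ := by
        have := re_inner_le_norm (𝕜 := ℂ) (T₁ y) (-B y)
        rw [inner_neg_right, norm_neg] at this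
        simpa using this
      have h6 : ‖T₁ y‖ * ‖B y‖ ≤ ‖T₁ y‖ * (1 / 2 * ‖T₁ y‖) := by
        gcongr; exact hBsmall y
      have h7 : ‖T₁ y‖ ^ 2 ≤ 0 := by nlinarith
      exact norm_eq_zero.1 (pow_eq_zero_iff two_ne_zero |>.1 (le_antisymm h7 (sq_nonneg _)))
  intro z
  obtain ⟨y, hy⟩ := hsurj z
  refine ⟨⟨y, y.2, h.domain_le_right y.2⟩, ?_⟩
  rw [← hy]
  change (H y + (α : ℂ) • G ⟨(y : E), h.domain_le_right y.2⟩) + _ = (H y + _) + _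
  rw [hBy]
  change _ + (Complex.I * μ) • (y : E) = _ + (Complex.I * μ) • (y : E) + _
  abel

end IsAdmissiblePair

namespace IsUnitaryGroupOf

variable {E : Type*} [NormedAddCommGroup E] [InnerProductSpace ℂ E] [CompleteSpace E]
  {A : E →ₗ.[ℂ] E} {V : ℝ → E →L[ℂ] E}

theorem inner_apply_apply (hV : IsUnitaryGroupOf A V) (t : ℝ) (x y : E) :
    ⟪V t x, V t y⟫_ℂ = ⟪x, y⟫_ℂ := by
  have h : ContinuousLinearMap.adjoint (V t) * V t = 1 := (Unitary.mem_iff.1 (hV.unitary t)).1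
  rw [← ContinuousLinearMap.adjoint_inner_right, ← mul_apply_eq_comp, h]; rfl

theorem norm_apply (hV : IsUnitaryGroupOf A V) (t : ℝ) (x : E) : ‖V t x‖ = ‖x‖ := by
  rw [norm_eq_sqrt_re_inner (𝕜 := ℂ), hV.inner_apply_apply, ← norm_eq_sqrt_re_inner]

theorem apply_neg_apply (hV : IsUnitaryGroupOf A V) (t : ℝ) (x : E) : V (-t) (V t x) = x := by
  rw [← mul_apply_eq_comp, ← hV.map_add, neg_add_cancel, hV.map_zero]; rfl

theorem inner_apply_left (hV : IsUnitaryGroupOf A V) (t : ℝ) (x y : E) :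
    ⟪V t x, y⟫_ℂ = ⟪x, V (-t) y⟫_ℂ := by
  rw [← hV.inner_apply_apply t x (V (-t) y)]
  congr 1
  simpa using (hV.apply_neg_apply (-t) y).symm

/-- The derivative at `0` of an orbit determines the derivative at every other time. -/
theorem hasDerivAt_of_zero (hV : IsUnitaryGroupOf A V) {x d : E}
    (h : HasDerivAt (fun t => V t x) d 0) (s : ℝ) : HasDerivAt (fun t => V t x) (V s d) s := by
  have h1 : HasDerivAt (fun t => V (t - s) x) d s := by
    have h2 : HasDerivAt (fun t => V t x) d (s - s) := by rwa [sub_self]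
    exact h2.comp_sub_const s s
  have h3 : HasDerivAt (fun t => V s (V (t - s) x)) (V s d) s :=
    ((V s).restrictScalars ℝ).hasFDerivAt.comp_hasDerivAt s h1
  refine h3.congr_of_eventuallyEq (Filter.Eventually.of_forall fun t => ?_)
  beta_reduce
  rw [← mul_apply_eq_comp, ← hV.map_add, add_sub_cancel]

/-- If `A + i μ` is onto for some `μ > 0`, then `A` is the full generator of the unitary group:
every vector with a differentiable orbit lies in the domain of `A`. -/
theorem mem_domain_of_hasDerivAt (hV : IsUnitaryGroupOf A V) {μ : ℝ} (hμ : 0 < μ)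
    (hsurj : ∀ z : E, ∃ y : A.domain, A y + (Complex.I * μ) • (y : E) = z) {x d : E}
    (h : HasDerivAt (fun t => V t x) (-Complex.I • d) 0) :
    ∃ hx : x ∈ A.domain, A ⟨x, hx⟩ = d := by
  obtain ⟨y, hy⟩ := hsurj (d + (Complex.I * μ) • x)
  -- the difference `w` would decay like `exp(-μ t)` to first order, contradicting unitarity
  set w := x - (y : E) with hw
  have hdy : d - A y = -((Complex.I * μ) • w) := by
    rw [hw, smul_sub]
    have : A y = d + (Complex.I * μ) • x - (Complex.I * μ) • (y : E) := by rw [← hy]; abel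
    rw [this]; abel
  have h1 : HasDerivAt (fun t => V t w) (-(μ : ℂ) • w) 0 := by
    have h2 := h.sub (hV.hasDerivAt y)
    have e : -Complex.I • d - -Complex.I • A y = -(μ : ℂ) • w := by
      rw [← smul_sub, hdy, ← neg_smul, smul_smul]
      congr 1
      linear_combination (μ : ℂ) * Complex.I_mul_I
    rw [e] at h2
    refine h2.congr_of_eventuallyEq (Filter.Eventually.of_forall fun t => ?_)
    simp [hw]
  have h3 := h1.inner ℂ h1
  have h4 : (fun t => ⟪V t w, V t w⟫_ℂ) = fun _ => ⟪w, w⟫_ℂ :=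
    funext fun t => hV.inner_apply_apply t w w
  rw [h4] at h3
  have h5 := h3.unique (hasDerivAt_const 0 _)
  have hw0 : w = 0 := by
    rw [hV.map_zero] at h5
    simp only [one_apply_eq_self, inner_smul_left, inner_smul_right, map_neg,
      Complex.conj_ofReal] at h5
    have h6 : (-(2 * μ : ℝ) : ℂ) * ⟪w, w⟫_ℂ = 0 := by
      rw [← h5]; push_cast; ring
    have hne : (-(2 * μ : ℝ) : ℂ) ≠ 0 := by
      simp [hμ.ne']
    exact inner_self_eq_zero.1 ((mul_eq_zero.1 h6).resolve_left hne)
  have hxy : x = y := sub_eq_zero.1 hw0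
  refine ⟨hxy ▸ y.2, ?_⟩
  have : d - A y = 0 := by rw [hdy, hw0, smul_zero, neg_zero]
  rw [sub_eq_zero] at this
  rw [this]
  congr 1
  exact Subtype.ext hxy

/-- The unitary group leaves the domain of its generator invariant and commutes with it. -/
theorem apply_mem_domain (hV : IsUnitaryGroupOf A V) {μ : ℝ} (hμ : 0 < μ)
    (hsurj : ∀ z : E, ∃ y : A.domain, A y + (Complex.I * μ) • (y : E) = z) (x : A.domain) (s : ℝ) :
    ∃ hx : V s x ∈ A.domain, A ⟨V s x, hx⟩ = V s (A x) := by
  refine hV.mem_domain_of_hasDerivAt hμ hsurj ?_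
  have h : HasDerivAt (fun t => V s (V t (x : E))) (V s (-Complex.I • A x)) 0 :=
    ((V s).restrictScalars ℝ).hasFDerivAt.comp_hasDerivAt 0 (hV.hasDerivAt x)
  rw [map_smul] at h
  refine h.congr_of_eventuallyEq (Filter.Eventually.of_forall fun t => ?_)
  beta_reduce
  rw [← mul_apply_eq_comp, ← mul_apply_eq_comp, ← hV.map_add, ← hV.map_add, add_comm]

end IsUnitaryGroupOf

/-- Vectors in the domain of `H` stay in it under the unitary group of `H + α G`, and their images
under `G` stay bounded, uniformly in time and for `α` in bounded sets. -/
theorem IsAdmissiblePair.exists_orbit_bound {E : Type*} [NormedAddCommGroup E]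
    [InnerProductSpace ℂ E] [CompleteSpace E] {H G : E →ₗ.[ℂ] E} (h : IsAdmissiblePair H G)
    {V : ℝ → ℝ → E →L[ℂ] E} (hV : ∀ α : ℝ, IsUnitaryGroupOf (H + (α : ℂ) • G) (V α))
    {R : ℝ} (hR : 0 ≤ R) (e : H.domain) :
    ∃ C : ℝ, 0 ≤ C ∧ ∀ α : ℝ, |α| ≤ R → ∀ s : ℝ,
      ∃ (hH : V α s e ∈ H.domain) (hG : V α s e ∈ G.domain),
        HasDerivAt (fun s => V α s (e : E))
          (-Complex.I • (H ⟨V α s e, hH⟩ + (α : ℂ) • G ⟨V α s e, hG⟩)) s ∧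
        ‖G ⟨V α s e, hG⟩‖ ≤ C := by
  obtain ⟨m, hm0, hm⟩ := h.exists_norm_sq_le
  have heG : (e : E) ∈ G.domain := h.domain_le_right e.2
  set N := ‖(e : E)‖ with hN
  set M := ‖H e‖ + R * ‖G ⟨e, heG⟩‖ with hM
  refine ⟨2 * R * N + 1 + (2 * N * M + m * N ^ 2), by positivity, fun α hα s => ?_⟩
  obtain ⟨μ, hμ, hsurj⟩ := h.exists_surjective α
  let e' : (H + (α : ℂ) • G).domain := ⟨e, e.2, heG⟩
  obtain ⟨hx, hAx⟩ := (hV α).apply_mem_domain hμ hsurj e' s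
  have hH : V α s e ∈ H.domain := hx.1
  have hG : V α s e ∈ G.domain := hx.2
  have hA : H ⟨V α s e, hH⟩ + (α : ℂ) • G ⟨V α s e, hG⟩ =
      V α s (H e + (α : ℂ) • G ⟨e, heG⟩) := hAx
  refine ⟨hH, hG, ?_, ?_⟩
  · rw [hA, ← map_smul]
    exact (hV α).hasDerivAt_of_zero ((hV α).hasDerivAt e') s
  · have hy : ‖V α s e‖ = N := (hV α).norm_apply s e
    have hAy : ‖H ⟨V α s e, hH⟩ + (α : ℂ) • G ⟨V α s e, hG⟩‖ ≤ M := by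
      rw [hA, (hV α).norm_apply]
      refine (norm_add_le _ _).trans ?_
      rw [norm_smul, Complex.norm_real, Real.norm_eq_abs]
      exact add_le_add_right (mul_le_mul_of_nonneg_right hα (norm_nonneg _)) _
    have h1 := hm _ hH
    set y := V α s e with hydef
    set X := ‖G ⟨y, hG⟩‖ with hX
    have h2 : (⟪y, H ⟨y, hH⟩⟫_ℂ).re ≤ N * M + R * (N * X) := by
      have e1 : ⟪y, H ⟨y, hH⟩⟫_ℂ = ⟪y, H ⟨y, hH⟩ + (α : ℂ) • G ⟨y, hG⟩⟫_ℂ -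
          (α : ℂ) * ⟪y, G ⟨y, hG⟩⟫_ℂ := by
        rw [inner_add_right, inner_smul_right]; ring
      refine (Complex.re_le_norm _).trans ?_
      rw [e1]
      refine (norm_sub_le _ _).trans ?_
      rw [norm_mul, Complex.norm_real, Real.norm_eq_abs]
      gcongr
      · refine (norm_inner_le_norm _ _).trans ?_
        rw [hy]; gcongr
      · refine (norm_inner_le_norm _ _).trans ?_
        rw [hy]
    rw [hy] at h1
    -- the quadratic inequality `X² ≤ 2 R N X + (2 N M + m N²)` bounds `X`
    by_contra! hlt
    have hN0 : 0 ≤ N := norm_nonneg _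
    have hM0 : 0 ≤ M := by positivity
    have ha : 0 ≤ 2 * N * M + m * N ^ 2 := by positivity
    have hb : 0 ≤ 2 * R * N := by positivity
    have hX1 : 1 ≤ X := by linarith
    have h3 : X ^ 2 ≤ 2 * R * N * X + (2 * N * M + m * N ^ 2) := by
      change X ^ 2 ≤ _ at h1
      linarith
    nlinarith [mul_nonneg ha (sub_nonneg.2 hX1), mul_lt_mul_of_pos_right hlt (by linarith : 0 < X)]

/-! ### Orthogonal sums -/

section Orthogonal

variable {E ι : Type*} [NormedAddCommGroup E] [InnerProductSpace ℂ E]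

theorem norm_sum_sq_of_pairwise_inner_eq_zero (s : Finset ι) (f : ι → E)
    (h : Pairwise fun i j => ⟪f i, f j⟫_ℂ = 0) :
    ‖∑ i ∈ s, f i‖ ^ 2 = ∑ i ∈ s, ‖f i‖ ^ 2 := by
  classical
  induction s using Finset.induction_on with
  | empty => simp
  | insert a s ha ih =>
    rw [Finset.sum_insert ha, Finset.sum_insert ha, ← ih]
    have h0 : ⟪f a, ∑ i ∈ s, f i⟫_ℂ = 0 := by
      rw [inner_sum]
      exact Finset.sum_eq_zero fun i hi => h fun e => ha (e ▸ hi)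
    simpa only [sq] using norm_add_sq_eq_norm_sq_add_norm_sq_of_inner_eq_zero _ _ h0

theorem sum_norm_le_of_pairwise_inner_eq_zero (s : Finset ι) (f : ι → E)
    (h : Pairwise fun i j => ⟪f i, f j⟫_ℂ = 0) :
    ∑ i ∈ s, ‖f i‖ ≤ √s.card * ‖∑ i ∈ s, f i‖ := by
  refine (pow_le_pow_iff_left₀ (Finset.sum_nonneg fun _ _ => norm_nonneg _) (by positivity)
    two_ne_zero).1 ?_
  rw [mul_pow, Real.sq_sqrt (by positivity), norm_sum_sq_of_pairwise_inner_eq_zero s f h]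
  exact sq_sum_le_card_mul_sum_sq

theorem norm_sum_smul_le_of_pairwise_inner_eq_zero (s : Finset ι) (f : ι → E)
    (h : Pairwise fun i j => ⟪f i, f j⟫_ℂ = 0) (c : ι → ℂ) {C : ℝ} (hC : 0 ≤ C)
    (hc : ∀ i ∈ s, ‖c i‖ ≤ C) : ‖∑ i ∈ s, c i • f i‖ ≤ C * ‖∑ i ∈ s, f i‖ := by
  have h' : Pairwise fun i j => ⟪c i • f i, c j • f j⟫_ℂ = 0 := fun i j hij => by
    beta_reduce
    rw [inner_smul_left, inner_smul_right, h hij, mul_zero, mul_zero]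
  refine (pow_le_pow_iff_left₀ (norm_nonneg _) (by positivity) two_ne_zero).1 ?_
  rw [norm_sum_sq_of_pairwise_inner_eq_zero s _ h', mul_pow,
    norm_sum_sq_of_pairwise_inner_eq_zero s f h, Finset.mul_sum]
  refine Finset.sum_le_sum fun i hi => ?_
  rw [norm_smul, mul_pow]
  gcongr
  exact hc i hi

theorem norm_sum_le_sum_of_subset {s t : Finset ι} (hst : s ⊆ t) (f : ι → E)
    (h : Pairwise fun i j => ⟪f i, f j⟫_ℂ = 0) : ‖∑ i ∈ s, f i‖ ≤ ‖∑ i ∈ t, f i‖ := by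
  refine (pow_le_pow_iff_left₀ (norm_nonneg _) (norm_nonneg _) two_ne_zero).1 ?_
  rw [norm_sum_sq_of_pairwise_inner_eq_zero s f h, norm_sum_sq_of_pairwise_inner_eq_zero t f h]
  exact Finset.sum_le_sum_of_subset_of_nonneg hst fun _ _ _ => by positivity

theorem sum_inner_range_by_parts (p v : ℕ → E) (K : ℕ) :
    ∑ k ∈ Finset.range (K + 1), ⟪p k, v k⟫_ℂ =
      ⟪∑ k ∈ Finset.range (K + 1), p k, v K⟫_ℂ -
        ∑ k ∈ Finset.range K, ⟪∑ i ∈ Finset.range (k + 1), p i, v (k + 1) - v k⟫_ℂ := by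
  induction K with
  | zero => simp
  | succ K ih =>
    rw [Finset.sum_range_succ, ih, Finset.sum_range_succ (n := K)
      (f := fun k => ⟪∑ i ∈ Finset.range (k + 1), p i, v (k + 1) - v k⟫_ℂ),
      Finset.sum_range_succ (n := K + 1) (f := p), inner_add_left, inner_sub_right]
    ring

/-- A bound for a Schur multiplier acting on the matrix of an operator with respect to two
orthogonal families: it is enough that the multiplier is bounded and of bounded variation in the
first index. This follows from summation by parts. -/
theorem norm_sum_mul_inner_le (p q : ℕ → E) (hp : Pairwise fun i j => ⟪p i, p j⟫_ℂ = 0)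
    (hq : Pairwise fun i j => ⟪q i, q j⟫_ℂ = 0) (A : E →L[ℂ] E) (c : ℕ → ℕ → ℂ) (K J : ℕ)
    {C d : ℝ} (hC : 0 ≤ C) (hd : 0 ≤ d) (h1 : ∀ k ≤ K, ∀ j < J, ‖c k j‖ ≤ C)
    (h2 : ∀ k < K, ∀ j < J, ‖c (k + 1) j - c k j‖ ≤ d) :
    ‖∑ k ∈ Finset.range (K + 1), ∑ j ∈ Finset.range J, c k j * ⟪p k, A (q j)⟫_ℂ‖ ≤
      (C + K * d) * ‖A‖ * ‖∑ k ∈ Finset.range (K + 1), p k‖ * ‖∑ j ∈ Finset.range J, q j‖ := by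
  set v : ℕ → E := fun k => A (∑ j ∈ Finset.range J, c k j • q j) with hv
  set a := ‖∑ k ∈ Finset.range (K + 1), p k‖
  set b := ‖∑ j ∈ Finset.range J, q j‖
  have e : ∑ k ∈ Finset.range (K + 1), ∑ j ∈ Finset.range J, c k j * ⟪p k, A (q j)⟫_ℂ =
      ∑ k ∈ Finset.range (K + 1), ⟪p k, v k⟫_ℂ := by
    refine Finset.sum_congr rfl fun k _ => ?_
    rw [hv]
    simp only [map_sum, map_smul, inner_sum, inner_smul_right]
  have hvK : ‖v K‖ ≤ ‖A‖ * (C * b) := by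
    refine (A.le_opNorm _).trans ?_
    gcongr
    exact norm_sum_smul_le_of_pairwise_inner_eq_zero _ q hq _ hC fun j hj =>
      h1 K le_rfl j (Finset.mem_range.1 hj)
  have hvd : ∀ k < K, ‖v (k + 1) - v k‖ ≤ ‖A‖ * (d * b) := fun k hk => by
    simp only [hv]
    rw [← map_sub, ← Finset.sum_sub_distrib]
    simp only [← sub_smul]
    refine (A.le_opNorm _).trans ?_
    gcongr
    exact norm_sum_smul_le_of_pairwise_inner_eq_zero _ q hq _ hd fun j hj =>
      h2 k hk j (Finset.mem_range.1 hj)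
  rw [e, sum_inner_range_by_parts]
  calc _ ≤ a * (‖A‖ * (C * b)) + ∑ k ∈ Finset.range K, a * (‖A‖ * (d * b)) := by
        refine (norm_sub_le _ _).trans (add_le_add ?_ ?_)
        · refine (norm_inner_le_norm _ _).trans ?_
          gcongr
        · refine norm_sum_le_of_le _ fun k hk => ?_
          have hk := Finset.mem_range.1 hk
          refine (norm_inner_le_norm _ _).trans ?_
          gcongr
          · exact norm_sum_le_sum_of_subset
              (Finset.range_mono (Nat.succ_le_succ hk.le)) p hp
          · exact hvd k hk
    _ = _ := by
        rw [Finset.sum_const, Finset.card_range, nsmul_eq_mul]; ring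

end Orthogonal

/-! ### Comparison of the total time evolution with product evolutions -/

section Duhamel

/-- The product rule for `r ↦ U(-r) z(r)`, where `U` is only strongly differentiable. -/
theorem IsUnitaryGroupOf.hasDerivAt_neg_apply {E : Type*} [NormedAddCommGroup E]
    [InnerProductSpace ℂ E] [CompleteSpace E] {A : E →ₗ.[ℂ] E} {U : ℝ → E →L[ℂ] E}
    (hU : IsUnitaryGroupOf A U) {z : ℝ → E} {z' : E} {r : ℝ} (hz : HasDerivAt z z' r)
    (hA : z r ∈ A.domain) :
    HasDerivAt (fun r => U (-r) (z r)) (U (-r) (Complex.I • A ⟨z r, hA⟩ + z')) r := by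
  have h1 : HasDerivAt (fun s => U (-s) (z r)) (U (-r) (Complex.I • A ⟨z r, hA⟩)) r := by
    have h2 := (hU.hasDerivAt_of_zero (hU.hasDerivAt ⟨z r, hA⟩) (-r)).scomp r (hasDerivAt_neg r)
    refine h2.congr_deriv ?_
    rw [neg_smul, neg_smul, map_neg, smul_neg, neg_neg, one_smul]
  -- the increment of `z`: `U (-s)` is isometric, so only strong continuity is needed
  have h2 : HasDerivAt (fun s => U (-s) (z s - z r)) (U (-r) z') r := by
    rw [hasDerivAt_iff_isLittleO] at hz ⊢
    have h3 : (fun s => U (-s) (z s - z r - (s - r) • z')) =o[nhds r] fun s => s - r :=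
      Asymptotics.IsLittleO.of_norm_left (hz.norm_left.congr_left fun s => (hU.norm_apply _ _).symm)
    have h4 : (fun s => (s - r) • (U (-s) z' - U (-r) z')) =o[nhds r] fun s => s - r := by
      have h5 : Filter.Tendsto (fun s => U (-s) z' - U (-r) z') (nhds r) (nhds 0) := by
        have h6 : Continuous fun s => U (-s) z' - U (-r) z' :=
          ((hU.continuous z').comp continuous_neg).sub continuous_const
        simpa using h6.tendsto r
      have h7 := (Asymptotics.isBigO_refl (fun s : ℝ => s - r) (nhds r)).smul_isLittleO
        ((Asymptotics.isLittleO_one_iff ℝ).2 h5)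
      simpa using h7
    refine (h3.add h4).congr_left fun s => ?_
    have e : U (-s) ((s - r) • z') = (s - r) • U (-s) z' :=
      ((U (-s)).restrictScalars ℝ).map_smul _ _
    rw [map_sub, e, smul_sub, sub_self, _root_.map_zero, sub_zero]
    abel
  refine ((h1.add h2).congr_deriv ((U (-r)).map_add _ _).symm).congr_of_eventuallyEq
    (Filter.Eventually.of_forall fun s => ?_)
  simp

variable {HilbS HilbE : Type*}
  [NormedAddCommGroup HilbS] [InnerProductSpace ℂ HilbS]
  [NormedAddCommGroup HilbE] [InnerProductSpace ℂ HilbE]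
  {HS F : HilbS →ₗ.[ℂ] HilbS} {HE G : HilbE →ₗ.[ℂ] HilbE}

theorem totalHamiltonian_tmul {x : HilbS} {y : HilbE} (hxH : x ∈ HS.domain) (hxF : x ∈ F.domain)
    (hyH : y ∈ HE.domain) (hyG : y ∈ G.domain) :
    ∃ h : tmul x y ∈ (totalHamiltonian HS F HE G).domain,
      totalHamiltonian HS F HE G ⟨tmul x y, h⟩ =
        tmul (HS ⟨x, hxH⟩) y + tmul x (HE ⟨y, hyH⟩) + tmul (F ⟨x, hxF⟩) (G ⟨y, hyG⟩) := by
  have h1 := unboundedTensor_tmul HS (identity HilbE) ⟨x, hxH⟩ ⟨y, trivial⟩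
  have h2 := unboundedTensor_tmul (identity HilbS) HE ⟨x, trivial⟩ ⟨y, hyH⟩
  have h3 := unboundedTensor_tmul F G ⟨x, hxF⟩ ⟨y, hyG⟩
  refine ⟨⟨⟨tmul_mem_unboundedTensor_domain HS (identity HilbE) ⟨x, hxH⟩ ⟨y, trivial⟩,
    tmul_mem_unboundedTensor_domain (identity HilbS) HE ⟨x, trivial⟩ ⟨y, hyH⟩⟩,
    tmul_mem_unboundedTensor_domain F G ⟨x, hxF⟩ ⟨y, hyG⟩⟩, ?_⟩
  exact congrArg₂ (· + ·) (congrArg₂ (· + ·) h1 h2) h3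

/-- The phase factor `exp(-i r h)`. -/
def phase (r h : ℝ) : ℂ := Complex.exp (-(Complex.I * h) * r)

theorem norm_phase (r h : ℝ) : ‖phase r h‖ = 1 := by
  have : phase r h = Complex.exp (((-(h * r) : ℝ) : ℂ) * Complex.I) := by
    rw [phase]; congr 1; push_cast; ring
  rw [this, Complex.norm_exp_ofReal_mul_I]

theorem phase_zero (h : ℝ) : phase 0 h = 1 := by simp [phase]

theorem hasDerivAt_phase (r h : ℝ) :
    HasDerivAt (fun r => phase r h) (phase r h * -(Complex.I * h)) r := by
  have h1 : HasDerivAt (fun r : ℝ => -(Complex.I * h) * (r : ℂ)) (-(Complex.I * h)) r := by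
    simpa using (Complex.ofRealCLM.hasDerivAt (x := r)).const_mul (-(Complex.I * h))
  exact h1.cexp

/-- The derivative of a product evolution in the interaction picture: the terms with `HE + α G` and
`h` cancel, and only the deviations `HS - h` and `F - α` remain. -/
theorem hasDerivAt_interaction {U : ℝ → HilbertTensor HilbS HilbE →L[ℂ] HilbertTensor HilbS HilbE}
    (hU : IsUnitaryGroupOf (totalHamiltonian HS F HE G) U) {f : HilbS} (hfH : f ∈ HS.domain)
    (hfF : f ∈ F.domain) {y : ℝ → HilbE} {α r : ℝ} (h : ℝ) (hyH : y r ∈ HE.domain)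
    (hyG : y r ∈ G.domain) (hy : HasDerivAt y
      (-Complex.I • (HE ⟨y r, hyH⟩ + (α : ℂ) • G ⟨y r, hyG⟩)) r) :
    HasDerivAt (fun r => U (-r) (phase r h • tmul f (y r)))
      (U (-r) (Complex.I • (tmul (phase r h • (HS ⟨f, hfH⟩ - (h : ℂ) • f)) (y r) +
        tmul (phase r h • (F ⟨f, hfF⟩ - (α : ℂ) • f)) (G ⟨y r, hyG⟩)))) r := by
  obtain ⟨hD, hD'⟩ := totalHamiltonian_tmul (HS := HS) (F := F) (HE := HE) (G := G) hfH hfF hyH hyG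
  have h1 : HasDerivAt (fun r => tmul f (y r))
      (tmul f (-Complex.I • (HE ⟨y r, hyH⟩ + (α : ℂ) • G ⟨y r, hyG⟩))) r :=
    ((tmulL HilbS HilbE f).restrictScalars ℝ).hasFDerivAt.comp_hasDerivAt r hy
  have h2 := (hasDerivAt_phase r h).smul h1
  have hmem : phase r h • tmul f (y r) ∈ (totalHamiltonian HS F HE G).domain :=
    (totalHamiltonian HS F HE G).domain.smul_mem _ hD
  have h3 := hU.hasDerivAt_neg_apply h2 hmem
  refine h3.congr_deriv (congrArg _ ?_)
  have e : totalHamiltonian HS F HE G ⟨phase r h • tmul f (y r), hmem⟩ =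
      phase r h • totalHamiltonian HS F HE G ⟨tmul f (y r), hD⟩ :=
    (totalHamiltonian HS F HE G).map_smul (phase r h) ⟨tmul f (y r), hD⟩
  change Complex.I • totalHamiltonian HS F HE G ⟨phase r h • tmul f (y r), hmem⟩ + _ = _
  rw [e, hD']
  simp only [tmul_smul_left, tmul_smul_right, tmul_sub_left, tmul_add_right, smul_add, smul_sub,
    smul_smul]
  module

variable [CompleteSpace HilbS]

variable {QS PS : ProjectionMeasure HilbS}

/-- Duhamel's estimate: on a joint spectral subspace of `F` and `HS` the total time evolution is
close to a product of a phase factor and the evolution generated by `HE + α G`. -/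
theorem norm_evolution_sub_le
    (hS : IsAdmissiblePair HS F) (hQS : IsSpectralMeasure HS QS) (hPS : IsSpectralMeasure F PS)
    {U : ℝ → HilbertTensor HilbS HilbE →L[ℂ] HilbertTensor HilbS HilbE}
    (hU : IsUnitaryGroupOf (totalHamiltonian HS F HE G) U)
    {I : Set ℝ} (hI : MeasurableSet I) {α ε : ℝ} (hε0 : 0 < ε) (hε : ∀ l ∈ I, |l - α| ≤ ε)
    (s : Finset ℕ) {J : ℕ → Set ℝ} (hJ : ∀ l, MeasurableSet (J l)) {h : ℕ → ℝ} {η : ℝ}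
    (hη0 : 0 < η) (hη : ∀ l, ∀ a ∈ J l, |a - h l| ≤ η) {f : ℕ → HilbS}
    (hfP : ∀ l, PS.proj I (f l) = f l) (hfQ : ∀ l, QS.proj (J l) (f l) = f l)
    (hf : Pairwise fun i j => ⟪f i, f j⟫_ℂ = 0) {y : ℝ → HilbE} {C N : ℝ}
    (hN : ∀ r, ‖y r‖ = N)
    (hy : ∀ r, ∃ (hH : y r ∈ HE.domain) (hG : y r ∈ G.domain),
        HasDerivAt y (-Complex.I • (HE ⟨y r, hH⟩ + (α : ℂ) • G ⟨y r, hG⟩)) r ∧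
        ‖G ⟨y r, hG⟩‖ ≤ C) (t : ℝ) :
    ‖U t (tmul (∑ l ∈ s, f l) (y 0)) - tmul (∑ l ∈ s, phase t (h l) • f l) (y t)‖ ≤
      (η * (∑ l ∈ s, ‖f l‖) * N + ε * ‖∑ l ∈ s, f l‖ * C) * |t| := by
  have hfH : ∀ l, f l ∈ HS.domain := fun l => hQS.mem_domain (hJ l) (hη l) (hfQ l)
  have hfF : ∀ l, f l ∈ F.domain := fun l => hPS.mem_domain hI hε (hfP l)
  have hC : 0 ≤ C := by
    obtain ⟨_, _, _, h0⟩ := hy 0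
    exact (norm_nonneg _).trans h0
  have hN0 : 0 ≤ N := (hN 0) ▸ norm_nonneg _
  choose hyH hyG hyd hyC using hy
  set D : ℝ → HilbertTensor HilbS HilbE := fun r =>
    ∑ l ∈ s, U (-r) (phase r (h l) • tmul (f l) (y r)) with hDdef
  have hD : ∀ r, HasDerivAt D (∑ l ∈ s, U (-r) (Complex.I •
      (tmul (phase r (h l) • (HS ⟨f l, hfH l⟩ - (h l : ℂ) • f l)) (y r) +
        tmul (phase r (h l) • (F ⟨f l, hfF l⟩ - (α : ℂ) • f l)) (G ⟨y r, hyG r⟩)))) r :=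
    fun r => HasDerivAt.fun_sum fun l _ =>
      hasDerivAt_interaction hU (hfH l) (hfF l) (h l) (hyH r) (hyG r) (hyd r)
  have hbound : ∀ r, ‖∑ l ∈ s, U (-r) (Complex.I •
      (tmul (phase r (h l) • (HS ⟨f l, hfH l⟩ - (h l : ℂ) • f l)) (y r) +
        tmul (phase r (h l) • (F ⟨f l, hfF l⟩ - (α : ℂ) • f l)) (G ⟨y r, hyG r⟩)))‖ ≤
      η * (∑ l ∈ s, ‖f l‖) * N + ε * ‖∑ l ∈ s, f l‖ * C := fun r => by
    rw [← map_sum, hU.norm_apply, ← Finset.smul_sum, norm_smul, Complex.norm_I, one_mul,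
      Finset.sum_add_distrib, ← tmul_sum_left, ← tmul_sum_left]
    refine (norm_add_le _ _).trans ?_
    rw [norm_tmul, norm_tmul, hN]
    have e1 : ‖∑ l ∈ s, phase r (h l) • (HS ⟨f l, hfH l⟩ - (h l : ℂ) • f l)‖ ≤
        η * ∑ l ∈ s, ‖f l‖ := by
      rw [Finset.mul_sum]
      refine norm_sum_le_of_le _ fun l _ => ?_
      rw [norm_smul, norm_phase, one_mul]
      exact hQS.norm_apply_sub_le hS.selfAdjoint_left (hJ l) hη0 (hη l) ⟨f l, hfH l⟩ (hfQ l)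
    -- `F - α` acts on a single vector of the spectral subspace, so no sum over `l` is lost here
    have e2 : ‖∑ l ∈ s, phase r (h l) • (F ⟨f l, hfF l⟩ - (α : ℂ) • f l)‖ ≤
        ε * ‖∑ l ∈ s, f l‖ := by
      set g : F.domain := ∑ l ∈ s, phase r (h l) • (⟨f l, hfF l⟩ : F.domain) with hg
      have hgv : (g : HilbS) = ∑ l ∈ s, phase r (h l) • f l := by
        simp [hg]
      have hFg : F g = ∑ l ∈ s, phase r (h l) • F ⟨f l, hfF l⟩ := by
        have := map_sum F.toFun (fun l => phase r (h l) • (⟨f l, hfF l⟩ : F.domain)) s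
        simp only [map_smul] at this
        exact this
      have e3 : ∑ l ∈ s, phase r (h l) • (F ⟨f l, hfF l⟩ - (α : ℂ) • f l) =
          F g - (α : ℂ) • (g : HilbS) := by
        rw [hFg, hgv, Finset.smul_sum, ← Finset.sum_sub_distrib]
        refine Finset.sum_congr rfl fun l _ => ?_
        rw [smul_sub, smul_comm]
      rw [e3]
      refine (hPS.norm_apply_sub_le hS.selfAdjoint_right hI hε0 hε g ?_).trans ?_
      · rw [hgv, map_sum]
        exact Finset.sum_congr rfl fun l _ => by rw [map_smul, hfP]
      · rw [hgv]
        gcongr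
        simpa using norm_sum_smul_le_of_pairwise_inner_eq_zero s f hf _ zero_le_one
          fun l _ => (norm_phase r (h l)).le
    gcongr
    exact hyC r
  have hmv := convex_univ.norm_image_sub_le_of_norm_hasDerivWithin_le
    (fun r _ => (hD r).hasDerivWithinAt) (fun r _ => hbound r) (Set.mem_univ (0 : ℝ))
    (Set.mem_univ t)
  rw [sub_zero, Real.norm_eq_abs] at hmv
  refine le_trans (le_of_eq ?_) hmv
  have hDt : D t = U (-t) (tmul (∑ l ∈ s, phase t (h l) • f l) (y t)) := by
    simp only [hDdef, ← map_sum, tmul_sum_left, tmul_smul_left]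
  have hD0 : D 0 = tmul (∑ l ∈ s, f l) (y 0) := by
    simp only [hDdef, neg_zero, hU.map_zero, phase_zero, one_smul, tmul_sum_left,
      one_apply_eq_self]
  rw [hDt, hD0, ← hU.norm_apply (-t), map_sub, hU.apply_neg_apply, norm_sub_rev]

end Duhamel

/-! ### Discretization of spectral measures -/

section Cells

variable {a b : ℝ} {n k : ℕ}

/-- The `k`-th cell of the interval `[a, b]`, subdivided into pieces of length `1 / n` starting
from `a`. The last cell may be shorter, and all later cells are empty. The subdivision is
meaningful for `n > 0` only. -/
def cell (a b : ℝ) (n k : ℕ) : Set ℝ := Set.Icc a b ∩ {l | ⌊(l - a) * n⌋₊ = k}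

/-- The left end point of the `k`-th cell. -/
def cellPoint (a : ℝ) (n k : ℕ) : ℝ := a + k / n

/-- The index of the last cell. -/
def lastCell (a b : ℝ) (n : ℕ) : ℕ := ⌊(b - a) * n⌋₊

theorem measurableSet_cell : MeasurableSet (cell a b n k) := by
  refine measurableSet_Icc.inter ?_
  have h : Measurable fun l : ℝ => ⌊(l - a) * n⌋₊ :=
    Nat.measurable_floor.comp ((measurable_id.sub_const a).mul_const _)
  exact h (measurableSet_singleton k)

theorem cell_inter_cell_eq_empty {i j : ℕ} (h : i ≠ j) : cell a b n i ∩ cell a b n j = ∅ :=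
  Set.eq_empty_of_forall_notMem fun _ hl => h (hl.1.2.symm.trans hl.2.2)

theorem iUnion_cell : ⋃ k, cell a b n k = Set.Icc a b := by
  ext l
  simp [cell]

theorem cell_eq_empty (h : lastCell a b n < k) : cell a b n k = ∅ := by
  refine Set.eq_empty_of_forall_notMem fun l hl => ?_
  have h1 : ⌊(l - a) * n⌋₊ ≤ lastCell a b n := by
    refine Nat.floor_le_floor ?_
    have := hl.1.2
    gcongr
  have h2 : ⌊(l - a) * n⌋₊ = k := hl.2
  omega

theorem abs_sub_cellPoint_le (hn : 0 < n) {l : ℝ} (hl : l ∈ cell a b n k) :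
    |l - cellPoint a n k| ≤ 1 / n := by
  have hn' : (0 : ℝ) < n := by exact_mod_cast hn
  have h1 : ⌊(l - a) * n⌋₊ = k := hl.2
  rw [Nat.floor_eq_iff (mul_nonneg (sub_nonneg.2 hl.1.1) hn'.le)] at h1
  have e : l - cellPoint a n k = ((l - a) * n - k) / n := by
    rw [cellPoint]; field_simp; ring
  rw [e, abs_div, abs_of_pos hn']
  gcongr
  rw [abs_le]
  constructor <;> linarith [h1.1, h1.2]

theorem lastCell_le (hab : a ≤ b) : (lastCell a b n : ℝ) ≤ (b - a) * n :=
  Nat.floor_le (mul_nonneg (sub_nonneg.2 hab) n.cast_nonneg)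

theorem cellPoint_mem (hab : a ≤ b) (hn : 0 < n) (hk : k ≤ lastCell a b n) :
    cellPoint a n k ∈ Set.Icc a b := by
  have hn' : (0 : ℝ) < n := by exact_mod_cast hn
  have h1 : (k : ℝ) ≤ (b - a) * n := le_trans (by exact_mod_cast hk) (lastCell_le hab)
  have h2 : (k : ℝ) / n ≤ b - a := (div_le_iff₀ hn').2 h1
  have h3 : (0 : ℝ) ≤ k / n := by positivity
  constructor <;> rw [cellPoint] <;> linarith

theorem sqrt_card_cells_le (hab : a ≤ b) (hn : 0 < n) :
    √((Finset.range (lastCell a b n + 1)).card) ≤ √(b - a + 1) * √n := by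
  have hn' : (1 : ℝ) ≤ n := by exact_mod_cast hn
  rw [← Real.sqrt_mul (by linarith), Finset.card_range]
  refine Real.sqrt_le_sqrt ?_
  push_cast
  nlinarith [lastCell_le (n := n) hab]

end Cells

namespace ProjectionMeasure

variable {E : Type*} [NormedAddCommGroup E] [InnerProductSpace ℂ E] [CompleteSpace E]
  (P : ProjectionMeasure E) {a b : ℝ} {n : ℕ}

theorem sum_proj_cell (x : E) : ∑ k ∈ Finset.range (lastCell a b n + 1), P.proj (cell a b n k) x =
    P.proj (Set.Icc a b) x := by
  have h := P.hasSum_iUnion (cell a b n) (fun _ => measurableSet_cell)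
    (fun i j hij => Set.disjoint_iff_inter_eq_empty.2 (cell_inter_cell_eq_empty hij)) x
  rw [iUnion_cell] at h
  refine (hasSum_sum_of_ne_finset_zero fun k hk => ?_).unique h
  rw [Finset.mem_range, not_lt] at hk
  rw [cell_eq_empty (Nat.lt_of_succ_le hk), P.empty]
  rfl

theorem inner_proj_cell (x y : E) {i j : ℕ} (h : i ≠ j) :
    ⟪P.proj (cell a b n i) x, P.proj (cell a b n j) y⟫_ℂ = 0 := by
  rw [P.inner_proj_left measurableSet_cell, P.proj_proj measurableSet_cell measurableSet_cell,
    cell_inter_cell_eq_empty h, P.empty]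
  exact inner_zero_right _

/-- A discretization of `exp(-i t H)`, where `H` has the spectral measure `P`, on the spectral
subspace of `[-R, R]`. -/
def phaseSum (R : ℝ) (n : ℕ) (t : ℝ) : E →L[ℂ] E :=
  ∑ l ∈ Finset.range (lastCell (-R) R n + 1),
    phase t (cellPoint (-R) n l) • P.proj (cell (-R) R n l)

theorem phaseSum_apply (R : ℝ) (n : ℕ) (t : ℝ) (x : E) : P.phaseSum R n t x =
    ∑ l ∈ Finset.range (lastCell (-R) R n + 1),
      phase t (cellPoint (-R) n l) • P.proj (cell (-R) R n l) x := by
  simp only [phaseSum, sum_apply, smul_apply]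

theorem norm_phaseSum_apply_le (R : ℝ) (n : ℕ) (t : ℝ) (x : E) :
    ‖P.phaseSum R n t x‖ ≤ ‖x‖ := by
  rw [phaseSum_apply]
  refine (norm_sum_smul_le_of_pairwise_inner_eq_zero _ _
    (fun i j hij => P.inner_proj_cell x x hij) _ zero_le_one
    fun l _ => (norm_phase _ _).le).trans ?_
  rw [P.sum_proj_cell, one_mul]
  exact P.norm_proj_le measurableSet_Icc x

variable {P} {Q : ProjectionMeasure E}

theorem proj_comm (hcomm : ∀ s t : Set ℝ, MeasurableSet s → MeasurableSet t →
    Commute (Q.proj s) (P.proj t)) {s t : Set ℝ} (hs : MeasurableSet s) (ht : MeasurableSet t)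
    (x : E) : Q.proj s (P.proj t x) = P.proj t (Q.proj s x) :=
  congrArg (fun T : E →L[ℂ] E => T x) (hcomm s t hs ht).eq

theorem proj_phaseSum (hcomm : ∀ s t : Set ℝ, MeasurableSet s → MeasurableSet t →
    Commute (Q.proj s) (P.proj t)) (R : ℝ) (n : ℕ) (t : ℝ) {s : Set ℝ} (hs : MeasurableSet s)
    (x : E) : P.proj s (Q.phaseSum R n t x) = Q.phaseSum R n t (P.proj s x) := by
  simp only [phaseSum_apply, map_sum, map_smul]
  exact Finset.sum_congr rfl fun l _ => by rw [proj_comm hcomm measurableSet_cell hs]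

end ProjectionMeasure

/-- Uniformly bounded operators that converge to zero on a dense set converge to zero strongly. -/
theorem tendsto_zero_of_dense {E F : Type*} [NormedAddCommGroup E] [NormedSpace ℂ E]
    [NormedAddCommGroup F] [NormedSpace ℂ F] {D : Set E} (hD : Dense D) (T : ℕ → E →L[ℂ] F) {M : ℝ}
    (hM : ∀ n u, ‖T n u‖ ≤ M * ‖u‖)
    (h : ∀ u ∈ D, Filter.Tendsto (fun n => T n u) Filter.atTop (nhds 0)) (u : E) :
    Filter.Tendsto (fun n => T n u) Filter.atTop (nhds 0) := by
  rw [Metric.tendsto_atTop]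
  intro ε hε
  obtain ⟨v, hvu, hv⟩ := Metric.dense_iff.1 hD u (ε / (2 * (|M| + 1))) (by positivity)
  obtain ⟨N, hN⟩ := Metric.tendsto_atTop.1 (h v hv) (ε / 2) (by positivity)
  refine ⟨N, fun n hn => ?_⟩
  have h1 := hN n hn
  rw [dist_zero_right] at h1 ⊢
  have h2 : ‖T n (u - v)‖ < ε / 2 := by
    rw [Metric.mem_ball, dist_comm, dist_eq_norm] at hvu
    calc ‖T n (u - v)‖ ≤ M * ‖u - v‖ := hM n _
      _ ≤ (|M| + 1) * ‖u - v‖ := by gcongr; linarith [le_abs_self M]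
      _ < (|M| + 1) * (ε / (2 * (|M| + 1))) := by gcongr
      _ = ε / 2 := by field_simp
  calc ‖T n u‖ = ‖T n (u - v) + T n v‖ := by rw [← map_add, sub_add_cancel]
    _ ≤ ‖T n (u - v)‖ + ‖T n v‖ := norm_add_le _ _
    _ < ε := by linarith

/-! ### Approximation of the total time evolution -/

section Approximation

variable {HilbS HilbE : Type*}
  [NormedAddCommGroup HilbS] [InnerProductSpace ℂ HilbS] [CompleteSpace HilbS]
  [NormedAddCommGroup HilbE] [InnerProductSpace ℂ HilbE]

/-- The component of `f` in the `k`-th spectral cell of `PS`, evolved by the discretization of the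
unitary group with spectral measure `QS`. The cells of `QS` are of size `1 / n²`, so that their
contribution to the error is small compared to the number of cells of `PS`. -/
def evolvedComponent (QS PS : ProjectionMeasure HilbS) (t R a b : ℝ) (n : ℕ) (f : HilbS) (k : ℕ) :
    HilbS :=
  QS.phaseSum R (n ^ 2) t (PS.proj (cell a b n k) f)

/-- The approximation `u ↦ ∑ k, f k ⊗ V (α k) t u` of the total time evolution of `f ⊗ u`, where
`f k` are the evolved components of `f`. -/
def approxEvolution (QS PS : ProjectionMeasure HilbS) (V : ℝ → ℝ → HilbE →L[ℂ] HilbE)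
    (t R a b : ℝ) (n : ℕ) (f : HilbS) : HilbE →L[ℂ] HilbertTensor HilbS HilbE :=
  ∑ k ∈ Finset.range (lastCell a b n + 1),
    (tmulL HilbS HilbE (evolvedComponent QS PS t R a b n f k)).comp (V (cellPoint a n k) t)

variable {QS PS : ProjectionMeasure HilbS} {V : ℝ → ℝ → HilbE →L[ℂ] HilbE} {t R a b : ℝ} {n : ℕ}
  {f : HilbS}

theorem approxEvolution_apply (u : HilbE) : approxEvolution QS PS V t R a b n f u =
    ∑ k ∈ Finset.range (lastCell a b n + 1),
      tmul (evolvedComponent QS PS t R a b n f k) (V (cellPoint a n k) t u) := by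
  simp only [approxEvolution, sum_apply, ContinuousLinearMap.comp_apply, tmulL_apply]

theorem inner_evolvedComponent (hcomm : ∀ s t : Set ℝ, MeasurableSet s → MeasurableSet t →
    Commute (QS.proj s) (PS.proj t)) :
    Pairwise fun i j => ⟪evolvedComponent QS PS t R a b n f i,
      evolvedComponent QS PS t R a b n f j⟫_ℂ = 0 := fun i j hij => by
  beta_reduce
  rw [evolvedComponent, evolvedComponent,
    ← ProjectionMeasure.proj_phaseSum hcomm _ _ _ measurableSet_cell,
    ← ProjectionMeasure.proj_phaseSum hcomm _ _ _ measurableSet_cell, PS.inner_proj_cell _ _ hij]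

theorem norm_sum_evolvedComponent_le :
    ‖∑ k ∈ Finset.range (lastCell a b n + 1), evolvedComponent QS PS t R a b n f k‖ ≤ ‖f‖ := by
  simp only [evolvedComponent]
  rw [← map_sum, PS.sum_proj_cell]
  exact (QS.norm_phaseSum_apply_le _ _ _ _).trans (PS.norm_proj_le measurableSet_Icc f)

variable [CompleteSpace HilbE] {HS F : HilbS →ₗ.[ℂ] HilbS} {HE G : HilbE →ₗ.[ℂ] HilbE}

theorem norm_approxEvolution_le (hcomm : ∀ s t : Set ℝ, MeasurableSet s → MeasurableSet t →
    Commute (QS.proj s) (PS.proj t)) (hV : ∀ α : ℝ, IsUnitaryGroupOf (HE + (α : ℂ) • G) (V α))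
    (u : HilbE) : ‖approxEvolution QS PS V t R a b n f u‖ ≤ ‖f‖ * ‖u‖ := by
  refine (pow_le_pow_iff_left₀ (norm_nonneg _) (by positivity) two_ne_zero).1 ?_
  rw [approxEvolution_apply, norm_sum_sq_of_pairwise_inner_eq_zero _ _ fun i j hij => by
    beta_reduce
    rw [inner_tmul_tmul, inner_evolvedComponent hcomm hij, zero_mul]]
  simp only [norm_tmul, (hV _).norm_apply, mul_pow]
  rw [← Finset.sum_mul, ← norm_sum_sq_of_pairwise_inner_eq_zero _ _ (inner_evolvedComponent hcomm)]
  gcongr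
  exact norm_sum_evolvedComponent_le

/-- The approximation converges on vectors in the domain of `HE`. There are of order `n` spectral
cells, on each of which Duhamel's estimate yields an error of order `1 / n` relative to the norm of
the component; by orthogonality the sum of these norms is of order `√n`. -/
theorem tendsto_approxEvolution_of_mem_domain
    (hS : IsAdmissiblePair HS F) (hE : IsAdmissiblePair HE G)
    (hQS : IsSpectralMeasure HS QS) (hPS : IsSpectralMeasure F PS)
    (hcomm : ∀ s t : Set ℝ, MeasurableSet s → MeasurableSet t →
      Commute (QS.proj s) (PS.proj t))
    {U : ℝ → HilbertTensor HilbS HilbE →L[ℂ] HilbertTensor HilbS HilbE}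
    (hU : IsUnitaryGroupOf (totalHamiltonian HS F HE G) U)
    (hV : ∀ α : ℝ, IsUnitaryGroupOf (HE + (α : ℂ) • G) (V α))
    (hR : 0 ≤ R) (hab : a ≤ b) (hfP : PS.proj (Set.Icc a b) f = f)
    (hfQ : QS.proj (Set.Icc (-R) R) f = f) (u : HE.domain) :
    Filter.Tendsto (fun n => U t (tmul f u) - approxEvolution QS PS V t R a b n f u)
      Filter.atTop (nhds 0) := by
  obtain ⟨C, hC, horb⟩ := hE.exists_orbit_bound hV (R := max |a| |b|) (by positivity) u
  set M : ℝ := (√(R - -R + 1) * ‖(u : HilbE)‖ + C) * |t| * (√(b - a + 1) * ‖f‖) with hM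
  -- one cell costs `1 / n` relative to its component, and the components add up to order `√n`
  have key : ∀ n : ℕ, 0 < n →
      ‖U t (tmul f u) - approxEvolution QS PS V t R a b n f u‖ ≤ M * (√n)⁻¹ := by
    intro n hn
    have hn' : (0 : ℝ) < n := by exact_mod_cast hn
    have hn2 : 0 < n ^ 2 := by positivity
    have hstep : ∀ k ∈ Finset.range (lastCell a b n + 1),
        ‖U t (tmul (PS.proj (cell a b n k) f) u) -
          tmul (evolvedComponent QS PS t R a b n f k) (V (cellPoint a n k) t u)‖ ≤
        1 / n * ((√(R - -R + 1) * ‖(u : HilbE)‖ + C) * |t|) * ‖PS.proj (cell a b n k) f‖ := by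
      intro k hk
      set p := PS.proj (cell a b n k) f with hp
      have hα : |cellPoint a n k| ≤ max |a| |b| := by
        have h1 := cellPoint_mem hab hn (Nat.lt_succ_iff.1 (Finset.mem_range.1 hk))
        exact abs_le_max_abs_abs h1.1 h1.2
      have hpP : PS.proj (cell a b n k) p = p := by
        rw [hp, PS.proj_proj measurableSet_cell measurableSet_cell, Set.inter_self]
      have hsum : ∑ l ∈ Finset.range (lastCell (-R) R (n ^ 2) + 1),
          QS.proj (cell (-R) R (n ^ 2) l) p = p := by
        rw [QS.sum_proj_cell, hp,
          ProjectionMeasure.proj_comm hcomm measurableSet_Icc measurableSet_cell, hfQ]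
      have horth : Pairwise fun i j => ⟪QS.proj (cell (-R) R (n ^ 2) i) p,
          QS.proj (cell (-R) R (n ^ 2) j) p⟫_ℂ = 0 := fun i j hij => QS.inner_proj_cell p p hij
      have h := norm_evolution_sub_le hS hQS hPS hU (measurableSet_cell (a := a) (b := b) (n := n)
        (k := k)) (α := cellPoint a n k) (ε := 1 / n) (by positivity)
        (fun l hl => abs_sub_cellPoint_le hn hl)
        (Finset.range (lastCell (-R) R (n ^ 2) + 1)) (J := cell (-R) R (n ^ 2))
        (fun _ => measurableSet_cell) (h := cellPoint (-R) (n ^ 2)) (η := 1 / (n ^ 2 : ℕ))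
        (by positivity) (fun l x hx => abs_sub_cellPoint_le hn2 hx)
        (f := fun l => QS.proj (cell (-R) R (n ^ 2) l) p)
        (fun l => by rw [← ProjectionMeasure.proj_comm hcomm measurableSet_cell measurableSet_cell,
          hpP])
        (fun l => by rw [QS.proj_proj measurableSet_cell measurableSet_cell, Set.inter_self])
        horth (y := fun s => V (cellPoint a n k) s u) (fun s => (hV _).norm_apply s u)
        (fun s => horb _ hα s) t
      rw [hsum] at h
      simp only [(hV _).map_zero, one_apply_eq_self] at h
      rw [← QS.phaseSum_apply] at h
      refine h.trans ?_
      have hsq := sum_norm_le_of_pairwise_inner_eq_zero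
        (Finset.range (lastCell (-R) R (n ^ 2) + 1)) _ horth
      rw [hsum] at hsq
      have hcard := sqrt_card_cells_le (a := -R) (b := R) (by linarith) hn2
      have hsn : √((n ^ 2 : ℕ) : ℝ) = n := by
        push_cast
        exact Real.sqrt_sq hn'.le
      rw [hsn] at hcard
      have hl : ∑ l ∈ Finset.range (lastCell (-R) R (n ^ 2) + 1),
          ‖QS.proj (cell (-R) R (n ^ 2) l) p‖ ≤ √(R - -R + 1) * n * ‖p‖ :=
        hsq.trans (by gcongr)
      calc _ ≤ (1 / (n ^ 2 : ℕ) * (√(R - -R + 1) * n * ‖p‖) * ‖(u : HilbE)‖ +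
            1 / n * ‖p‖ * C) * |t| := by gcongr
        _ = _ := by
          push_cast
          field_simp
    have hf : U t (tmul f u) = ∑ k ∈ Finset.range (lastCell a b n + 1),
        U t (tmul (PS.proj (cell a b n k) f) u) := by
      rw [← map_sum, ← tmul_sum_left, PS.sum_proj_cell, hfP]
    rw [hf, approxEvolution_apply, ← Finset.sum_sub_distrib]
    refine (norm_sum_le_of_le _ hstep).trans ?_
    rw [← Finset.mul_sum]
    have hsq := sum_norm_le_of_pairwise_inner_eq_zero (Finset.range (lastCell a b n + 1))
      (fun k => PS.proj (cell a b n k) f) (fun i j hij => PS.inner_proj_cell f f hij)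
    rw [PS.sum_proj_cell, hfP] at hsq
    have hcard := sqrt_card_cells_le hab hn
    calc _ ≤ 1 / n * ((√(R - -R + 1) * ‖(u : HilbE)‖ + C) * |t|) *
          (√(b - a + 1) * √n * ‖f‖) := by
          gcongr
          exact hsq.trans (by gcongr)
      _ = M * (√n / n) := by rw [hM]; ring
      _ = M * (√n)⁻¹ := by rw [Real.sqrt_div_self]
  refine squeeze_zero_norm' (Filter.eventually_atTop.2 ⟨1, fun n hn => key n hn⟩) ?_
  have h := (Real.tendsto_sqrt_atTop.comp tendsto_natCast_atTop_atTop).inv_tendsto_atTop.const_mul M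
  simpa using h

/-- The approximation converges strongly. -/
theorem tendsto_approxEvolution
    (hS : IsAdmissiblePair HS F) (hE : IsAdmissiblePair HE G)
    (hQS : IsSpectralMeasure HS QS) (hPS : IsSpectralMeasure F PS)
    (hcomm : ∀ s t : Set ℝ, MeasurableSet s → MeasurableSet t →
      Commute (QS.proj s) (PS.proj t))
    {U : ℝ → HilbertTensor HilbS HilbE →L[ℂ] HilbertTensor HilbS HilbE}
    (hU : IsUnitaryGroupOf (totalHamiltonian HS F HE G) U)
    (hV : ∀ α : ℝ, IsUnitaryGroupOf (HE + (α : ℂ) • G) (V α))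
    (hR : 0 ≤ R) (hab : a ≤ b) (hfP : PS.proj (Set.Icc a b) f = f)
    (hfQ : QS.proj (Set.Icc (-R) R) f = f) (u : HilbE) :
    Filter.Tendsto (fun n => approxEvolution QS PS V t R a b n f u)
      Filter.atTop (nhds (U t (tmul f u))) := by
  have h := tendsto_zero_of_dense hE.selfAdjoint_left.dense_domain
    (fun n => (U t).comp (tmulL HilbS HilbE f) - approxEvolution QS PS V t R a b n f)
    (M := 2 * ‖f‖) (fun n u => ?_) (fun u hu =>
      tendsto_approxEvolution_of_mem_domain hS hE hQS hPS hcomm hU hV hR hab hfP hfQ ⟨u, hu⟩) u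
  · have h2 := h.const_sub (U t (tmul f u))
    rw [sub_zero] at h2
    refine h2.congr fun n => ?_
    rw [sub_apply, ContinuousLinearMap.comp_apply, tmulL_apply, sub_sub_cancel]
  · rw [sub_apply, ContinuousLinearMap.comp_apply, tmulL_apply]
    refine (norm_sub_le _ _).trans ?_
    rw [hU.norm_apply, norm_tmul]
    linarith [norm_approxEvolution_le (t := t) (R := R) (a := a) (b := b) (n := n) (f := f)
      hcomm hV u]

end Approximation

/-! ### The reduced dynamics in terms of the environment trace -/

section EnvironmentTrace

variable {HilbE : Type*} [NormedAddCommGroup HilbE] [InnerProductSpace ℂ HilbE]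
  [CompleteSpace HilbE] {HE G : HilbE →ₗ.[ℂ] HilbE} {V : ℝ → ℝ → HilbE →L[ℂ] HilbE}
  {σ : HilbE →L[ℂ] HilbE}

theorem hasSum_environmentTrace (hV : ∀ α : ℝ, IsUnitaryGroupOf (HE + (α : ℂ) • G) (V α))
    (hσ : ContinuousLinearMap.adjoint σ = σ)
    (hs : Summable fun i => ‖σ (basis HilbE i)‖ ^ 2) (α β t : ℝ) :
    HasSum (fun j => ⟪V α t (σ (basis HilbE j)), V β t (σ (basis HilbE j))⟫_ℂ)
      (environmentTrace V (σ * σ) α β t) := by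
  have h := (hasSum_inner_mul_sq (basis HilbE) hσ hs (V α (-t) * V β t)).tsum_eq
  have e : environmentTrace V (σ * σ) α β t =
      ∑' j, ⟪V α t (σ (basis HilbE j)), V β t (σ (basis HilbE j))⟫_ℂ := by
    rw [environmentTrace, trace]
    refine h.trans (tsum_congr fun j => ?_)
    rw [(hV α).inner_apply_left]
    rfl
  rw [e]
  refine (Summable.of_norm_bounded hs fun j => ?_).hasSum
  refine (norm_inner_le_norm _ _).trans_eq ?_
  rw [(hV α).norm_apply, (hV β).norm_apply, sq]

theorem conj_environmentTrace (hV : ∀ α : ℝ, IsUnitaryGroupOf (HE + (α : ℂ) • G) (V α))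
    (hσ : ContinuousLinearMap.adjoint σ = σ)
    (hs : Summable fun i => ‖σ (basis HilbE i)‖ ^ 2) (α β t : ℝ) :
    (starRingEnd ℂ) (environmentTrace V (σ * σ) α β t) = environmentTrace V (σ * σ) β α t := by
  rw [← (hasSum_environmentTrace hV hσ hs α β t).tsum_eq,
    ← (hasSum_environmentTrace hV hσ hs β α t).tsum_eq, Complex.conj_tsum]
  exact tsum_congr fun j => inner_conj_symm _ _

end EnvironmentTrace

section ReducedDynamics

open Filter Topology

variable {HilbS HilbE : Type*}
  [NormedAddCommGroup HilbS] [InnerProductSpace ℂ HilbS] [CompleteSpace HilbS]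
  [NormedAddCommGroup HilbE] [InnerProductSpace ℂ HilbE] [CompleteSpace HilbE]
  {HS F : HilbS →ₗ.[ℂ] HilbS} {HE G : HilbE →ₗ.[ℂ] HilbE}
  {QS PS : ProjectionMeasure HilbS} {V : ℝ → ℝ → HilbE →L[ℂ] HilbE}
  {U : ℝ → HilbertTensor HilbS HilbE →L[ℂ] HilbertTensor HilbS HilbE}
  {σ : HilbE →L[ℂ] HilbE} {A B : HilbS →L[ℂ] HilbS} {t R a b a' b' : ℝ} {f g : HilbS}

/-- The discretization of the double operator integral `∫∫ χ(α, β; t) P(dα) A₀(t) P(dβ)`. -/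
def doubleSum (QS PS : ProjectionMeasure HilbS) (V : ℝ → ℝ → HilbE →L[ℂ] HilbE)
    (ω : HilbE →L[ℂ] HilbE) (A : HilbS →L[ℂ] HilbS) (t R a b a' b' : ℝ) (f g : HilbS) (n : ℕ) : ℂ :=
  ∑ k ∈ Finset.range (lastCell a b n + 1), ∑ j ∈ Finset.range (lastCell a' b' n + 1),
    environmentTrace V ω (cellPoint a n k) (cellPoint a' n j) t *
      ⟪evolvedComponent QS PS t R a b n f k, A (evolvedComponent QS PS t R a' b' n g j)⟫_ℂ

theorem tsum_inner_approxEvolution (hV : ∀ α : ℝ, IsUnitaryGroupOf (HE + (α : ℂ) • G) (V α))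
    (hσ : ContinuousLinearMap.adjoint σ = σ)
    (hs : Summable fun i => ‖σ (basis HilbE i)‖ ^ 2) (n : ℕ) :
    ∑' i, ⟪approxEvolution QS PS V t R a b n f (σ (basis HilbE i)),
        boundedTensor A 1 (approxEvolution QS PS V t R a' b' n g (σ (basis HilbE i)))⟫_ℂ =
      doubleSum QS PS V (σ * σ) A t R a b a' b' f g n := by
  refine HasSum.tsum_eq ?_
  have h : HasSum (fun i => ∑ k ∈ Finset.range (lastCell a b n + 1),
      ∑ j ∈ Finset.range (lastCell a' b' n + 1),
        ⟪V (cellPoint a n k) t (σ (basis HilbE i)), V (cellPoint a' n j) t (σ (basis HilbE i))⟫_ℂ *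
        ⟪evolvedComponent QS PS t R a b n f k, A (evolvedComponent QS PS t R a' b' n g j)⟫_ℂ)
      (doubleSum QS PS V (σ * σ) A t R a b a' b' f g n) :=
    hasSum_sum fun k _ => hasSum_sum fun j _ =>
      (hasSum_environmentTrace hV hσ hs _ _ t).mul_right _
  refine h.congr_fun fun i => ?_
  rw [approxEvolution_apply, approxEvolution_apply, map_sum, sum_inner]
  refine Finset.sum_congr rfl fun k _ => ?_
  rw [inner_sum]
  refine Finset.sum_congr rfl fun j _ => ?_
  rw [boundedTensor_tmul, inner_tmul_tmul, one_apply_eq_self, mul_comm]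

/-- The matrix elements of the reduced observable are limits of discretized double operator
integrals of the environment trace. -/
theorem tendsto_doubleSum
    (hS : IsAdmissiblePair HS F) (hE : IsAdmissiblePair HE G)
    (hQS : IsSpectralMeasure HS QS) (hPS : IsSpectralMeasure F PS)
    (hcomm : ∀ s t : Set ℝ, MeasurableSet s → MeasurableSet t →
      Commute (QS.proj s) (PS.proj t))
    (hU : IsUnitaryGroupOf (totalHamiltonian HS F HE G) U)
    (hV : ∀ α : ℝ, IsUnitaryGroupOf (HE + (α : ℂ) • G) (V α))
    (hσ : ContinuousLinearMap.adjoint σ = σ)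
    (hs : Summable fun i => ‖σ (basis HilbE i)‖ ^ 2)
    (hB : HasPartialTrace (weightedObservable U (σ * σ) A t) B) (hR : 0 ≤ R)
    (hab : a ≤ b) (hfP : PS.proj (Set.Icc a b) f = f) (hfQ : QS.proj (Set.Icc (-R) R) f = f)
    (hab' : a' ≤ b') (hgP : PS.proj (Set.Icc a' b') g = g)
    (hgQ : QS.proj (Set.Icc (-R) R) g = g) :
    Tendsto (doubleSum QS PS V (σ * σ) A t R a b a' b' f g) atTop (𝓝 ⟪f, B g⟫_ℂ) := by
  have hB' : ⟪f, B g⟫_ℂ = ∑' j, ⟪U t (tmul f (σ (basis HilbE j))),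
      boundedTensor A 1 (U t (tmul g (σ (basis HilbE j))))⟫_ℂ := by
    rw [HasPartialTrace.inner_eq hσ hs hB]
    refine tsum_congr fun j => ?_
    rw [mul_apply_eq_comp, mul_apply_eq_comp, ContinuousLinearMap.adjoint_inner_right]
  rw [hB']
  have h := tendsto_tsum_of_dominated_convergence (𝓕 := atTop)
    (f := fun n i => ⟪approxEvolution QS PS V t R a b n f (σ (basis HilbE i)),
        boundedTensor A 1 (approxEvolution QS PS V t R a' b' n g (σ (basis HilbE i)))⟫_ℂ)
    (g := fun j => ⟪U t (tmul f (σ (basis HilbE j))),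
      boundedTensor A 1 (U t (tmul g (σ (basis HilbE j))))⟫_ℂ)
    (bound := fun i => ‖f‖ * (‖A‖ * ‖g‖) * ‖σ (basis HilbE i)‖ ^ 2)
    (hs.mul_left _) (fun i => ?_) (Eventually.of_forall fun n i => ?_)
  · exact h.congr fun n => tsum_inner_approxEvolution hV hσ hs n
  · exact (tendsto_approxEvolution hS hE hQS hPS hcomm hU hV hR hab hfP hfQ _).inner
      (((boundedTensor A 1).continuous.tendsto _).comp
        (tendsto_approxEvolution hS hE hQS hPS hcomm hU hV hR hab' hgP hgQ _))
  · refine (norm_inner_le_norm _ _).trans ?_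
    have h1 := norm_approxEvolution_le (t := t) (R := R) (a := a) (b := b) (n := n) (f := f)
      hcomm hV (σ (basis HilbE i))
    have h2 := norm_approxEvolution_le (t := t) (R := R) (a := a') (b := b') (n := n) (f := g)
      hcomm hV (σ (basis HilbE i))
    have h3 := (boundedTensor A (1 : HilbE →L[ℂ] HilbE)).le_of_opNorm_le
      (norm_boundedTensor_one_right_le A)
      (approxEvolution QS PS V t R a' b' n g (σ (basis HilbE i)))
    calc _ ≤ (‖f‖ * ‖σ (basis HilbE i)‖) * (‖A‖ * (‖g‖ * ‖σ (basis HilbE i)‖)) := by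
          gcongr
          exact h3.trans (by gcongr)
      _ = _ := by ring

/-- The discretized double operator integral is bounded when the environment trace is bounded and
Lipschitz continuous in its first argument. -/
theorem norm_doubleSum_le (hcomm : ∀ s t : Set ℝ, MeasurableSet s → MeasurableSet t →
      Commute (QS.proj s) (PS.proj t)) {ω : HilbE →L[ℂ] HilbE} {C : ℝ} (hC : 0 ≤ C)
    (hab : a ≤ b) (hab' : a' ≤ b')
    (h1 : ∀ α ∈ Set.Icc a b, ∀ β ∈ Set.Icc a' b', ‖environmentTrace V ω α β t‖ ≤ C)
    (h2 : ∀ α₁ ∈ Set.Icc a b, ∀ α₂ ∈ Set.Icc a b, ∀ β ∈ Set.Icc a' b',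
      ‖environmentTrace V ω α₂ β t - environmentTrace V ω α₁ β t‖ ≤ C * |α₂ - α₁|)
    {n : ℕ} (hn : 0 < n) :
    ‖doubleSum QS PS V ω A t R a b a' b' f g n‖ ≤ C * (1 + (b - a)) * ‖A‖ * ‖f‖ * ‖g‖ := by
  have hn' : (0 : ℝ) < n := by exact_mod_cast hn
  have h := norm_sum_mul_inner_le _ _
    (inner_evolvedComponent (t := t) (R := R) (a := a) (b := b) (n := n) (f := f) hcomm)
    (inner_evolvedComponent (t := t) (R := R) (a := a') (b := b') (n := n) (f := g) hcomm) A
    (fun k j => environmentTrace V ω (cellPoint a n k) (cellPoint a' n j) t)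
    (lastCell a b n) (lastCell a' b' n + 1) hC (d := C * (1 / n)) (by positivity)
    (fun k hk j hj => h1 _ (cellPoint_mem hab hn hk) _
      (cellPoint_mem hab' hn (Nat.lt_succ_iff.1 hj)))
    (fun k hk j hj => by
      refine (h2 _ (cellPoint_mem hab hn hk.le) _ (cellPoint_mem hab hn hk) _
        (cellPoint_mem hab' hn (Nat.lt_succ_iff.1 hj))).trans_eq ?_
      congr 1
      rw [cellPoint, cellPoint, ← abs_of_pos (by positivity : (0 : ℝ) < 1 / n)]
      congr 1
      push_cast
      ring)
  refine h.trans ?_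
  have hlast : C + lastCell a b n * (C * (1 / n)) ≤ C * (1 + (b - a)) := by
    have h3 : (lastCell a b n : ℝ) / n ≤ b - a := (div_le_iff₀ hn').2 (lastCell_le hab)
    calc C + lastCell a b n * (C * (1 / n)) = C * (1 + lastCell a b n / n) := by ring
      _ ≤ _ := by gcongr
  have hba : 0 ≤ b - a := sub_nonneg.2 hab
  gcongr
  · exact norm_sum_evolvedComponent_le
  · exact norm_sum_evolvedComponent_le

theorem conj_doubleSum (hV : ∀ α : ℝ, IsUnitaryGroupOf (HE + (α : ℂ) • G) (V α))
    (hσ : ContinuousLinearMap.adjoint σ = σ)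
    (hs : Summable fun i => ‖σ (basis HilbE i)‖ ^ 2) (n : ℕ) :
    (starRingEnd ℂ) (doubleSum QS PS V (σ * σ) A t R a b a' b' f g n) =
      doubleSum QS PS V (σ * σ) (ContinuousLinearMap.adjoint A) t R a' b' a b g f n := by
  rw [doubleSum, doubleSum, map_sum, Finset.sum_comm]
  simp only [map_sum, map_mul, conj_environmentTrace hV hσ hs, inner_conj_symm,
    ContinuousLinearMap.adjoint_inner_right]

end ReducedDynamics

/-! ### Estimates for the off-diagonal blocks -/

section Estimate

open Filter Topology

variable {HilbS HilbE : Type*}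
  [NormedAddCommGroup HilbS] [InnerProductSpace ℂ HilbS] [CompleteSpace HilbS]
  [NormedAddCommGroup HilbE] [InnerProductSpace ℂ HilbE] [CompleteSpace HilbE]
  {HS F : HilbS →ₗ.[ℂ] HilbS} {HE G : HilbE →ₗ.[ℂ] HilbE}
  {QS PS : ProjectionMeasure HilbS} {V : ℝ → ℝ → HilbE →L[ℂ] HilbE}
  {U : ℝ → HilbertTensor HilbS HilbE →L[ℂ] HilbertTensor HilbS HilbE}
  {σ : HilbE →L[ℂ] HilbE} {A B : HilbS →L[ℂ] HilbS} {t R a b a' b' C δ : ℝ} {f g : HilbS}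

theorem norm_doubleSum_le_of_deriv (hcomm : ∀ s t : Set ℝ, MeasurableSet s → MeasurableSet t →
      Commute (QS.proj s) (PS.proj t)) {ω : HilbE →L[ℂ] HilbE} (hC : 0 ≤ C)
    (hab : a ≤ b) (hab' : a' ≤ b')
    (hδ : ∀ α ∈ Set.Icc a b, ∀ β ∈ Set.Icc a' b', δ ≤ |α - β|)
    (hχ : ∀ α β : ℝ, δ ≤ |α - β| → ‖environmentTrace V ω α β t‖ ≤ C ∧
      DifferentiableAt ℝ (fun a => environmentTrace V ω a β t) α ∧
      ‖deriv (fun a => environmentTrace V ω a β t) α‖ ≤ C) {n : ℕ} (hn : 0 < n) :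
    ‖doubleSum QS PS V ω A t R a b a' b' f g n‖ ≤ C * (1 + (b - a)) * ‖A‖ * ‖f‖ * ‖g‖ := by
  refine norm_doubleSum_le hcomm hC hab hab' (fun α hα β hβ => (hχ α β (hδ α hα β hβ)).1)
    (fun α₁ h₁ α₂ h₂ β hβ => ?_) hn
  exact (convex_Icc a b).norm_image_sub_le_of_norm_deriv_le
    (f := fun a => environmentTrace V ω a β t)
    (fun α hα => (hχ α β (hδ α hα β hβ)).2.1) (fun α hα => (hχ α β (hδ α hα β hβ)).2.2) h₁ h₂

/-- The matrix elements of the reduced observable between spectral subspaces of `F` for compact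
intervals, with the length of either interval in the bound. The bound with the length of the second
interval results from the symmetry of the environment trace in its two arguments. -/
theorem norm_inner_partialTrace_le
    (hS : IsAdmissiblePair HS F) (hE : IsAdmissiblePair HE G)
    (hQS : IsSpectralMeasure HS QS) (hPS : IsSpectralMeasure F PS)
    (hcomm : ∀ s t : Set ℝ, MeasurableSet s → MeasurableSet t →
      Commute (QS.proj s) (PS.proj t))
    (hU : IsUnitaryGroupOf (totalHamiltonian HS F HE G) U)
    (hV : ∀ α : ℝ, IsUnitaryGroupOf (HE + (α : ℂ) • G) (V α))
    (hσ : ContinuousLinearMap.adjoint σ = σ)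
    (hs : Summable fun i => ‖σ (basis HilbE i)‖ ^ 2)
    (hB : HasPartialTrace (weightedObservable U (σ * σ) A t) B) (hC : 0 ≤ C)
    (hχ : ∀ α β : ℝ, δ ≤ |α - β| → ‖environmentTrace V (σ * σ) α β t‖ ≤ C ∧
      DifferentiableAt ℝ (fun a => environmentTrace V (σ * σ) a β t) α ∧
      ‖deriv (fun a => environmentTrace V (σ * σ) a β t) α‖ ≤ C) (hR : 0 ≤ R)
    (hab : a ≤ b) (hfP : PS.proj (Set.Icc a b) f = f) (hfQ : QS.proj (Set.Icc (-R) R) f = f)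
    (hab' : a' ≤ b') (hgP : PS.proj (Set.Icc a' b') g = g)
    (hgQ : QS.proj (Set.Icc (-R) R) g = g)
    (hδ : ∀ α ∈ Set.Icc a b, ∀ β ∈ Set.Icc a' b', δ ≤ |α - β|) :
    ‖⟪f, B g⟫_ℂ‖ ≤ C * (1 + (b - a)) * ‖A‖ * ‖f‖ * ‖g‖ ∧
      ‖⟪f, B g⟫_ℂ‖ ≤ C * (1 + (b' - a')) * ‖A‖ * ‖f‖ * ‖g‖ := by
  have hlim := (tendsto_doubleSum hS hE hQS hPS hcomm hU hV hσ hs hB hR hab hfP hfQ hab' hgP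
    hgQ).norm
  constructor
  · exact le_of_tendsto hlim (eventually_atTop.2 ⟨1, fun n hn =>
      norm_doubleSum_le_of_deriv hcomm hC hab hab' hδ hχ hn⟩)
  · refine le_of_tendsto hlim (eventually_atTop.2 ⟨1, fun n hn => ?_⟩)
    rw [← RCLike.norm_conj, conj_doubleSum hV hσ hs]
    refine (norm_doubleSum_le_of_deriv hcomm hC hab' hab
      (fun α hα β hβ => (hδ β hβ α hα).trans_eq (abs_sub_comm _ _)) hχ hn).trans_eq ?_
    rw [LinearIsometryEquiv.norm_map]
    ring

theorem isClosed_ordConnected_eq_empty_or_Icc {s : Set ℝ} (hs : IsClosed s) (hc : s.OrdConnected)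
    (hb : Bornology.IsBounded s) : s = ∅ ∨ ∃ a b, a ≤ b ∧ s = Set.Icc a b := by
  rcases s.eq_empty_or_nonempty with h | h
  · exact Or.inl h
  · have h1 := eq_Icc_of_connected_compact ⟨h, hc.isPreconnected⟩
      (Metric.isCompact_of_isClosed_isBounded hs hb)
    exact Or.inr ⟨_, _, Set.nonempty_Icc.1 (h1 ▸ h), h1⟩

/-- To estimate a block `P(Δ₁) B P(Δ₂)` it is enough to consider vectors in bounded joint spectral
subspaces. -/
theorem norm_proj_mul_mul_proj_le {E : Type*} [NormedAddCommGroup E] [InnerProductSpace ℂ E]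
    [CompleteSpace E] {P Q : ProjectionMeasure E}
    (hcomm : ∀ s t : Set ℝ, MeasurableSet s → MeasurableSet t → Commute (Q.proj s) (P.proj t))
    {Δ₁ Δ₂ : Set ℝ} (h₁ : MeasurableSet Δ₁) (h₂ : MeasurableSet Δ₂) (B : E →L[ℂ] E) {M : ℝ}
    (hM : 0 ≤ M)
    (h : ∀ (N : ℕ) (f g : E), P.proj (Δ₁ ∩ Set.Icc (-N) N) f = f →
      P.proj (Δ₂ ∩ Set.Icc (-N) N) g = g → Q.proj (Set.Icc (-N) N) f = f →
      Q.proj (Set.Icc (-N) N) g = g → ‖⟪f, B g⟫_ℂ‖ ≤ M * ‖f‖ * ‖g‖) :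
    ‖P.proj Δ₁ * B * P.proj Δ₂‖ ≤ M := by
  have hmono : Monotone fun N : ℕ => Set.Icc (-(N : ℝ)) N := fun m n hmn => by
    have : (m : ℝ) ≤ n := by exact_mod_cast hmn
    exact Set.Icc_subset_Icc (by linarith) this
  have hU : ⋃ N : ℕ, Set.Icc (-(N : ℝ)) N = Set.univ := Set.eq_univ_of_forall fun x => by
    obtain ⟨N, hN⟩ := exists_nat_ge |x|
    exact Set.mem_iUnion.2 ⟨N, abs_le.1 hN⟩
  -- the cut-off of `x` by bounded spectral subspaces
  let cut : Set ℝ → ℕ → E → E := fun Δ N x =>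
    P.proj (Δ ∩ Set.Icc (-(N : ℝ)) N) (Q.proj (Set.Icc (-(N : ℝ)) N) x)
  have hcut : ∀ Δ, MeasurableSet Δ → ∀ x, Tendsto (fun N => cut Δ N x) atTop (𝓝 (P.proj Δ x)) := by
    intro Δ hΔ x
    have hP := P.tendsto_proj _ (fun _ => measurableSet_Icc) hmono hU x
    have hQ := Q.tendsto_proj _ (fun _ => measurableSet_Icc) hmono hU x
    have h1 : Tendsto (fun N : ℕ => P.proj (Set.Icc (-(N : ℝ)) N)
        (Q.proj (Set.Icc (-(N : ℝ)) N) x - x)) atTop (𝓝 0) := by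
      refine squeeze_zero_norm (fun N => P.norm_proj_le measurableSet_Icc _) ?_
      exact tendsto_iff_norm_sub_tendsto_zero.1 hQ
    have h2 := ((P.proj Δ).continuous.tendsto _).comp (h1.add hP)
    rw [zero_add] at h2
    refine h2.congr fun N => ?_
    simp only [Function.comp, cut]
    rw [← map_add, sub_add_cancel, P.proj_proj hΔ measurableSet_Icc]
  have key : ∀ x y : E, ‖⟪P.proj Δ₁ x, B (P.proj Δ₂ y)⟫_ℂ‖ ≤ M * ‖x‖ * ‖y‖ := by
    intro x y
    have hlim := ((hcut Δ₁ h₁ x).inner (𝕜 := ℂ)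
      ((B.continuous.tendsto _).comp (hcut Δ₂ h₂ y))).norm
    refine le_of_tendsto hlim (Eventually.of_forall fun N => ?_)
    have hle : ∀ Δ, MeasurableSet Δ → ∀ z, ‖cut Δ N z‖ ≤ ‖z‖ := fun Δ hΔ z =>
      (P.norm_proj_le (hΔ.inter measurableSet_Icc) _).trans (Q.norm_proj_le measurableSet_Icc _)
    have hPc : ∀ Δ, MeasurableSet Δ → ∀ z, P.proj (Δ ∩ Set.Icc (-(N : ℝ)) N) (cut Δ N z) =
        cut Δ N z := fun Δ hΔ z => by
      simp only [cut]
      rw [P.proj_proj (hΔ.inter measurableSet_Icc) (hΔ.inter measurableSet_Icc), Set.inter_self]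
    have hQc : ∀ Δ, MeasurableSet Δ → ∀ z, Q.proj (Set.Icc (-(N : ℝ)) N) (cut Δ N z) =
        cut Δ N z := fun Δ hΔ z => by
      simp only [cut]
      rw [ProjectionMeasure.proj_comm hcomm measurableSet_Icc (hΔ.inter measurableSet_Icc),
        Q.proj_proj measurableSet_Icc measurableSet_Icc, Set.inter_self]
    refine (h N _ _ (hPc Δ₁ h₁ x) (hPc Δ₂ h₂ y) (hQc Δ₁ h₁ x) (hQc Δ₂ h₂ y)).trans ?_
    have h3 := hle Δ₁ h₁ x
    have h4 := hle Δ₂ h₂ y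
    gcongr
  refine ContinuousLinearMap.opNorm_le_bound _ hM fun y => ?_
  set z := (P.proj Δ₁ * B * P.proj Δ₂) y with hz
  have h5 := key z y
  rw [P.inner_proj_left h₁] at h5
  have h6 : ‖z‖ * ‖z‖ ≤ ‖z‖ * (M * ‖y‖) := by
    have h7 : ‖⟪z, z⟫_ℂ‖ = ‖z‖ * ‖z‖ := by
      rw [inner_self_eq_norm_sq_to_K]; simp [sq]
    rw [← h7]
    exact h5.trans_eq (by ring)
  rcases (norm_nonneg z).eq_or_lt with h0 | h0
  · rw [← h0]; positivity
  · exact le_of_mul_le_mul_left h6 h0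

end Estimate

end InducedSuperselection

end

theorem mainTheorem2 {HilbS HilbE : Type*}
    [NormedAddCommGroup HilbS] [InnerProductSpace ℂ HilbS] [CompleteSpace HilbS]
    [NormedAddCommGroup HilbE] [InnerProductSpace ℂ HilbE] [CompleteSpace HilbE]
    -- the Hamiltonians of the system and of the environment, and the coupling operators
    (HS F : HilbS →ₗ.[ℂ] HilbS) (HE G : HilbE →ₗ.[ℂ] HilbE)
    (hS : IsAdmissiblePair HS F) (hE : IsAdmissiblePair HE G)
    -- the spectral measures of `HS` and `F`; they commute
    (QS PS : ProjectionMeasure HilbS)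
    (hQS : IsSpectralMeasure HS QS) (hPS : IsSpectralMeasure F PS)
    (hcomm : ∀ s t : Set ℝ, MeasurableSet s → MeasurableSet t →
      Commute (QS.proj s) (PS.proj t))
    -- the unitary groups generated by the total Hamiltonian and by the operators `HE + α G`
    (U : ℝ → HilbertTensor HilbS HilbE →L[ℂ] HilbertTensor HilbS HilbE)
    (hU : IsUnitaryGroupOf (totalHamiltonian HS F HE G) U)
    (V : ℝ → ℝ → HilbE →L[ℂ] HilbE)
    (hV : ∀ α : ℝ, IsUnitaryGroupOf (HE + (α : ℂ) • G) (V α))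
    -- the reference state of the environment
    (ω : HilbE →L[ℂ] HilbE) (hω : IsStatisticalOperator ω)
    -- the bounds on the environment trace and its derivative
    (ψ : ℝ → ℝ) (hψ : ∀ t, 0 ≤ t → 0 ≤ ψ t) (c γ δ : ℝ) (hγ : 0 < γ) (hδ : 0 < δ)
    (hχ : ∀ t α β : ℝ, 0 ≤ t → δ ≤ |α - β| →
      ‖environmentTrace V ω α β t‖ ≤ c * (1 + (α - β) ^ 2 * ψ t) ^ (-γ) ∧
      DifferentiableAt ℝ (fun a => environmentTrace V ω a β t) α ∧
      ‖deriv (fun a => environmentTrace V ω a β t) α‖ ≤ c * (1 + (α - β) ^ 2 * ψ t) ^ (-γ)) :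
    (∀ (t : ℝ) (A : HilbS →L[ℂ] HilbS),
      HasPartialTrace (weightedObservable U ω A t) (reducedHeisenberg U ω A t)) ∧
    ∀ Δ₁ Δ₂ : Set ℝ, IsClosed Δ₁ → Δ₁.OrdConnected → IsClosed Δ₂ → Δ₂.OrdConnected →
      (∀ α ∈ Δ₁, ∀ β ∈ Δ₂, δ ≤ |α - β|) →
      ∀ (t : ℝ) (A : HilbS →L[ℂ] HilbS), 0 ≤ t →
        (Bornology.IsBounded Δ₁ →
          ‖PS.proj Δ₁ * reducedHeisenberg U ω A t * PS.proj Δ₂‖ ≤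
            c * (2 + Metric.diam Δ₁) * ‖A‖ * (1 + δ ^ 2 * ψ t) ^ (-γ)) ∧
        (Bornology.IsBounded Δ₂ →
          ‖PS.proj Δ₁ * reducedHeisenberg U ω A t * PS.proj Δ₂‖ ≤
            c * (2 + Metric.diam Δ₂) * ‖A‖ * (1 + δ ^ 2 * ψ t) ^ (-γ)) := by

  obtain ⟨σ, hσ, rfl, hσ1⟩ := hω.exists_sqrt
  have hs := hσ1.summable
  have htrace : ∀ (t : ℝ) (A : HilbS →L[ℂ] HilbS), HasPartialTrace
      (weightedObservable U (σ * σ) A t) (reducedHeisenberg U (σ * σ) A t) := fun t A => by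
    have h : ∃ B, HasPartialTrace (weightedObservable U (σ * σ) A t) B :=
      exists_hasPartialTrace hσ hs _
    rw [reducedHeisenberg, dif_pos h]
    exact h.choose_spec
  refine ⟨htrace, fun Δ₁ Δ₂ hc₁ ho₁ hc₂ ho₂ hΔ t A ht => ?_⟩
  have hbase : ∀ x : ℝ, 0 < 1 + x ^ 2 * ψ t := fun x => by
    have := mul_nonneg (sq_nonneg x) (hψ t ht)
    linarith
  -- the hypothesis itself forces `c` to be nonnegative
  have hc : 0 ≤ c := by
    have h := (hχ t δ 0 ht (by rw [sub_zero]; exact le_abs_self δ)).1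
    exact nonneg_of_mul_nonneg_left ((norm_nonneg _).trans h) (Real.rpow_pos_of_pos (hbase _) _)
  set C := c * (1 + δ ^ 2 * ψ t) ^ (-γ) with hCdef
  have hC : 0 ≤ C := mul_nonneg hc (Real.rpow_nonneg (hbase δ).le _)
  have hχC : ∀ α β : ℝ, δ ≤ |α - β| → ‖environmentTrace V (σ * σ) α β t‖ ≤ C ∧
      DifferentiableAt ℝ (fun a => environmentTrace V (σ * σ) a β t) α ∧
      ‖deriv (fun a => environmentTrace V (σ * σ) a β t) α‖ ≤ C := fun α β hαβ => by
    have hle : c * (1 + (α - β) ^ 2 * ψ t) ^ (-γ) ≤ C := by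
      refine mul_le_mul_of_nonneg_left (Real.rpow_le_rpow_of_nonpos (hbase δ) ?_ (by linarith)) hc
      have h1 : δ ^ 2 ≤ (α - β) ^ 2 := sq_le_sq.2 (by rwa [abs_of_pos hδ])
      have := mul_le_mul_of_nonneg_right h1 (hψ t ht)
      linarith
    obtain ⟨h1, h2, h3⟩ := hχ t α β ht hαβ
    exact ⟨h1.trans hle, h2, h3.trans hle⟩
  have hcut : ∀ (N : ℕ) (Δ : Set ℝ), IsClosed Δ → Δ.OrdConnected →
      Δ ∩ Set.Icc (-(N : ℝ)) N = ∅ ∨ ∃ a b, a ≤ b ∧ Δ ∩ Set.Icc (-(N : ℝ)) N = Set.Icc a b :=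
    fun N Δ h1 h2 => isClosed_ordConnected_eq_empty_or_Icc (h1.inter isClosed_Icc)
      (h2.inter Set.ordConnected_Icc) ((Metric.isBounded_Icc _ _).subset Set.inter_subset_right)
  have hlen : ∀ {N : ℕ} {Δ : Set ℝ} {a b : ℝ}, a ≤ b → Δ ∩ Set.Icc (-(N : ℝ)) N = Set.Icc a b →
      Bornology.IsBounded Δ → C * (1 + (b - a)) ≤ C * (2 + Metric.diam Δ) := by
    intro N Δ a b hab h hb
    have h1 := Metric.diam_mono (h ▸ Set.inter_subset_left : Set.Icc a b ⊆ Δ) hb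
    rw [Real.diam_Icc hab] at h1
    gcongr
    linarith
  -- the two estimates, reduced to compact intervals
  have main : ∀ M : ℝ, 0 ≤ M →
      (∀ (N : ℕ) (a b a' b' : ℝ), a ≤ b → a' ≤ b' → Δ₁ ∩ Set.Icc (-(N : ℝ)) N = Set.Icc a b →
        Δ₂ ∩ Set.Icc (-(N : ℝ)) N = Set.Icc a' b' →
        C * (1 + (b - a)) ≤ M ∨ C * (1 + (b' - a')) ≤ M) →
      ‖PS.proj Δ₁ * reducedHeisenberg U (σ * σ) A t * PS.proj Δ₂‖ ≤ M * ‖A‖ := by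
    intro M hM h
    refine norm_proj_mul_mul_proj_le hcomm hc₁.measurableSet hc₂.measurableSet _ (by positivity)
      fun N f g hfP hgP hfQ hgQ => ?_
    rcases hcut N Δ₁ hc₁ ho₁ with h1 | ⟨a, b, hab, h1⟩
    · rw [h1, PS.empty] at hfP
      rw [← hfP]
      simp
    rcases hcut N Δ₂ hc₂ ho₂ with h2 | ⟨a', b', hab', h2⟩
    · rw [h2, PS.empty] at hgP
      rw [← hgP]
      simp
    have hδ' : ∀ α ∈ Set.Icc a b, ∀ β ∈ Set.Icc a' b', δ ≤ |α - β| := fun α hα β hβ =>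
      hΔ α (h1 ▸ hα : α ∈ Δ₁ ∩ _).1 β (h2 ▸ hβ : β ∈ Δ₂ ∩ _).1
    rw [h1] at hfP
    rw [h2] at hgP
    have hest := norm_inner_partialTrace_le hS hE hQS hPS hcomm hU hV hσ hs (htrace t A) hC hχC
      (Nat.cast_nonneg N) hab hfP hfQ hab' hgP hgQ hδ'
    rcases h N a b a' b' hab hab' h1 h2 with h3 | h3
    · exact hest.1.trans (by gcongr)
    · exact hest.2.trans (by gcongr)
  constructor
  · intro hb
    refine (main (C * (2 + Metric.diam Δ₁)) (by positivity)
      fun N a b a' b' hab _ h1 _ => Or.inl (hlen hab h1 hb)).trans_eq ?_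
    rw [hCdef]; ring
  · intro hb
    refine (main (C * (2 + Metric.diam Δ₂)) (by positivity)
      fun N a b a' b' _ hab' _ h2 => Or.inr (hlen hab' h2 hb)).trans_eq ?_
    rw [hCdef]; ring
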